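/- Let $(X,d)$ be a (non-empty) complete separable metric space and let $\gamma:\mathbb{R}_+\to\mathbb{R}_+$ be lower semicontinuous with $\gamma(0)=0$ and $\gamma(u+v)\le C(\gamma(u)+\gamma(v))$ for all $u,v\ge 0$ and some constant $C$. Assume also that for every $r\ge0$ there is a constant $K$ with $\gamma(u)\le K(1+\gamma(v))$ whenever $|u-v|\le r$ (this is automatic if $\gamma$ is nondecreasing, or bounded, and ensures that the notions below do not depend on the base point $x_o$). Let $\mathcal{P}_\gamma(X)$ be the set of Borel probability measures $p$ on $X$ with $\int\gamma(d(x,x_o))\,p(dx)<\infty$ for some $x_o\in X$. Let $\Phi_\gamma(X)$ be the set of continuous $\varphi:X\to\mathbb{R}$ with $|\varphi(x)|\le a+b\,\gamma(d(x,x_o))$ for all $x$, for some $a,b\ge0$ and $x_o\in X$, and let $\Phi_{\gamma,b}(X)$ be the set of those $\varphi\in\Phi_\gamma(X)$ that are bounded from below. Equip $\mathcal{P}_\gamma(X)$ with the coarsest topology making $p\mapsto\int\varphi\,dp$ continuous for all $\varphi\in\Phi_\gamma(X)$, and with the $\sigma$-field generated by the maps $p\mapsto p(A)$, $A$ Borel.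 Define $\mathcal{P}_\gamma(X\times X)$ and its topology in the same way, with $\gamma(d(x,x_o))+\gamma(d(y,x_o))$ in place of $\gamma(d(x,x_o))$. Let $c:X\times\mathcal{P}_\gamma(X)\to[0,\infty]$ be measurable. For a probability measure $\pi(dx\,dy)=\pi_1(dx)\,p_x(dy)$ on $X\times X$ whose kernel satisfies $p_x\in\mathcal{P}_\gamma(X)$ for $\pi_1$-almost every $x$ (as it does when $\pi\in\mathcal{P}_\gamma(X\times X)$), put $I_c[\pi]=\int c(x,p_x)\,\pi_1(dx)$, and for $\mu,\nu\in\mathcal{P}_\gamma(X)$ let $\mathcal{T}_c(\nu|\mu)=\inf_\pi I_c[\pi]$, the infimum being over all couplings $\pi$ with first marginal $\mu$ and second marginal $\nu$. Consider the following conditions. - $(C_1)$ For every $\mu\in\mathcal{P}_\gamma(X)$, $\pi\mapsto I_c[\pi]$ is lower semicontinuous on the set of $\pi\in\mathcal{P}_\gamma(X\times X)$ with first marginal $\mu$. - $(C_2)$ For every $x\in X$, $p\mapsto c(x,p)$ is convex. - $(C_3)$ $(x,p)\mapsto c(x,p)$ is continuous for the product topology. - $(C_3')$ $X$ is compact and $(x,p)\mapsto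 c(x,p)$ is lower semicontinuous for the product topology. - $(C_3'')$ $X$ is a countable set of isolated points and, for every $x\in X$, $p\mapsto c(x,p)$ is lower semicontinuous. - $(C_4)$ If $\mu\in\mathcal{P}_\gamma(X)$ and $x\mapsto p_x\in\mathcal{P}_\gamma(X)$ is a measurable kernel with $\int c(x,p_x)\,\mu(dx)<\infty$, then $\mu p\in\mathcal{P}_\gamma(X)$, where $\mu p=\int p_x\,\mu(dx)$. Assume that one of the following holds: $(C)$: $(C_1),(C_2),(C_3),(C_4)$; $(C')$: $(C_1),(C_2),(C_3'),(C_4)$; $(C'')$: $(C_2),(C_3''),(C_4)$. For $\varphi\in\Phi_{\gamma,b}(X)$ put \[R_c\varphi(x)=\inf_{p\in\mathcal{P}_\gamma(X)}\Big\{\int\varphi\,dp+c(x,p)\Big\}\in(-\infty,\infty],\qquad x\in X.\] Then $R_c\varphi$ is Borel measurable (and it is bounded from below, so that its integrals are well defined in $(-\infty,\infty]$) for every $\varphi\in\Phi_{\gamma,b}(X)$, and for all $\mu,\nu\in\mathcal{P}_\gamma(X)$, \[\mathcal{T}_c(\nu|\mu)=\sup_{\varphi\in\Phi_{\gamma,b}(X)}\Big\{\int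 R_c\varphi\,d\mu-\int\varphi\,d\nu\Big\}.\] -/

import Mathlib

open MeasureTheory ProbabilityTheory Topology
open scoped NNReal ENNReal

namespace WeakTransport

/-- The standing assumptions on the growth function `γ : ℝ₊ → ℝ₊`. The last field says that `γ` at two
points at bounded distance is comparable up to constants; it is automatic when `γ` is nondecreasing
(by `quasi_subadd`) and when `γ` is bounded. It is what makes the notions below independent of the
base point in every metric space. -/
structure IsGrowthFunction (γ : ℝ≥0 → ℝ≥0) : Prop where
  lsc : LowerSemicontinuous γ
  map_zero : γ 0 = 0
  quasi_subadd : ∃ C : ℝ≥0, ∀ u v, γ (u + v) ≤ C * (γ u + γ v)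
  shift : ∀ r : ℝ≥0, ∃ K : ℝ≥0, ∀ u v, nndist u v ≤ r → γ u ≤ K * (1 + γ v)

section Weights

/-! A weight family `W` assigns to each base point `o` a weight `W o : Y → ℝ₊`. It is used for
`Y = X` with `W o x = γ (d (x, o))`, and for `Y = X × X` with
`W o (x, y) = γ (d (x, o)) + γ (d (y, o))`. -/

variable {B Y : Type*} [MeasurableSpace Y]

/-- The measure `m` integrates the weight, for some base point. -/
def HasMoment (W : B → Y → ℝ≥0) (m : Measure Y) : Prop :=
  ∃ o : B, ∫⁻ y, (W o y : ℝ≥0∞) ∂m < ∞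

/-- Continuous functions whose growth is controlled by the weight, for some base point. -/
def HasGrowth [TopologicalSpace Y] (W : B → Y → ℝ≥0) (φ : Y → ℝ) : Prop :=
  Continuous φ ∧ ∃ o : B, ∃ a b : ℝ, 0 ≤ a ∧ 0 ≤ b ∧ ∀ y, |φ y| ≤ a + b * (W o y : ℝ)

/-- Probability measures integrating the weight. This is a type of its own, so that it does not
inherit the topology of weak convergence. -/
structure WeightedProb (W : B → Y → ℝ≥0) where
  toProb : ProbabilityMeasure Y
  hasMoment : HasMoment W (toProb : Measure Y)

/-- The underlying measure. -/
def WeightedProb.meas {W : B → Y → ℝ≥0} (p : WeightedProb W) : Measure Y := (p.toProb : Measure Y)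

/-- The coarsest topology making `p ↦ ∫ φ dp` continuous for every continuous `φ` whose growth is
controlled by the weight. -/
noncomputable instance [TopologicalSpace Y] (W : B → Y → ℝ≥0) : TopologicalSpace (WeightedProb W) :=
  ⨅ φ : {φ : Y → ℝ // HasGrowth W φ},
    TopologicalSpace.induced (fun p : WeightedProb W => ∫ y, φ.1 y ∂p.meas) inferInstance

/-- The σ-field generated by the maps `p ↦ p A`, for `A` measurable. -/
instance (W : B → Y → ℝ≥0) : MeasurableSpace (WeightedProb W) :=
  MeasurableSpace.comap WeightedProb.meas inferInstance

end Weights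

/-- The weights `x ↦ γ (d (x, o))` on `X`. -/
def weight (γ : ℝ≥0 → ℝ≥0) (X : Type*) [PseudoMetricSpace X] (o x : X) : ℝ≥0 :=
  γ (nndist x o)

/-- The weights `(x, y) ↦ γ (d (x, o)) + γ (d (y, o))` on `X × X`. -/
def weightPair (γ : ℝ≥0 → ℝ≥0) (X : Type*) [PseudoMetricSpace X] (o : X) (z : X × X) : ℝ≥0 :=
  γ (nndist z.1 o) + γ (nndist z.2 o)

/-- The space `P_γ(X)`, with its topology and its σ-field. -/
abbrev PGamma (γ : ℝ≥0 → ℝ≥0) (X : Type*) [PseudoMetricSpace X] [MeasurableSpace X] :=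
  WeightedProb (weight γ X)

/-- The space `P_γ(X × X)`, with its topology. -/
abbrev PGammaPair (γ : ℝ≥0 → ℝ≥0) (X : Type*) [PseudoMetricSpace X] [MeasurableSpace X] :=
  WeightedProb (weightPair γ X)

/-- The class `Φ_{γ,b}(X)`: continuous functions with `γ`-growth, bounded from below. -/
def PhiB (γ : ℝ≥0 → ℝ≥0) (X : Type*) [PseudoMetricSpace X] [MeasurableSpace X] : Set (X → ℝ) :=
  {φ | HasGrowth (weight γ X) φ ∧ BddBelow (Set.range φ)}

/-- The integral, in the extended reals, of an extended-real function: the integral of its positive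
part minus the integral of its negative part. -/
noncomputable def extIntegral {X : Type*} [MeasurableSpace X] (μ : Measure X) (f : X → EReal) :
    EReal :=
  ((∫⁻ x, (f x).toENNReal ∂μ : ℝ≥0∞) : EReal) - ((∫⁻ x, (-f x).toENNReal ∂μ : ℝ≥0∞) : EReal)

section Costs

variable {X : Type*} [MetricSpace X] [MeasurableSpace X] {γ : ℝ≥0 → ℝ≥0}

open Classical in
/-- The cost `c (x, m)` for a probability measure `m`, set to `∞` when `m` is not in `P_γ(X)`. -/
noncomputable def extendCost (c : X → PGamma γ X → ℝ≥0∞) (x : X) (m : ProbabilityMeasure X) :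
    ℝ≥0∞ :=
  if h : HasMoment (weight γ X) (m : Measure X) then c x ⟨m, h⟩ else ∞

/-- `R_c φ (x) = inf_p { ∫ φ dp + c (x, p) }`, the infimum over `p` in `P_γ(X)`. -/
noncomputable def Rc (c : X → PGamma γ X → ℝ≥0∞) (φ : X → ℝ) (x : X) : EReal :=
  ⨅ p : PGamma γ X, (((∫ y, φ y ∂p.meas : ℝ) : EReal) + (c x p : EReal))

/-- The function `p ↦ c (x, p)` is convex for every `x`. -/
def CondC2 (c : X → PGamma γ X → ℝ≥0∞) : Prop :=
  ∀ (x : X) (p q r : PGamma γ X) (s t : ℝ≥0), s + t = 1 →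
    r.meas = s • p.meas + t • q.meas → c x r ≤ s * c x p + t * c x q

/-- The function `(x, p) ↦ c (x, p)` is continuous. -/
def CondC3 (c : X → PGamma γ X → ℝ≥0∞) : Prop :=
  Continuous (Function.uncurry c)

/-- `X` is compact and `(x, p) ↦ c (x, p)` is lower semicontinuous. -/
def CondC3' (c : X → PGamma γ X → ℝ≥0∞) : Prop :=
  CompactSpace X ∧ LowerSemicontinuous (Function.uncurry c)

/-- `X` is a countable set of isolated points and `p ↦ c (x, p)` is lower semicontinuous for
every `x`. -/
def CondC3'' (c : X → PGamma γ X → ℝ≥0∞) : Prop :=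
  Countable X ∧ DiscreteTopology X ∧ ∀ x, LowerSemicontinuous (c x)

/-- If `μ ∈ P_γ(X)` and `p` is a kernel with values in `P_γ(X)` and finite cost, then
`μ p ∈ P_γ(X)`. -/
def CondC4 (c : X → PGamma γ X → ℝ≥0∞) : Prop :=
  ∀ (μ : PGamma γ X) (p : X → PGamma γ X), Measurable p →
    ∫⁻ x, c x (p x) ∂μ.meas < ∞ →
      HasMoment (weight γ X) (μ.meas.bind (fun x => (p x).meas))

variable [BorelSpace X] [CompleteSpace X] [SecondCountableTopology X] [Nonempty X]

/-- `I_c[π] = ∫ c (x, p_x) π₁(dx)`, where `π₁` is the first marginal of `π` and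
`π(dx dy) = π₁(dx) p_x(dy)`. -/
noncomputable def Ic (c : X → PGamma γ X → ℝ≥0∞) (π : ProbabilityMeasure (X × X)) : ℝ≥0∞ :=
  ∫⁻ x, extendCost c x ⟨(π : Measure (X × X)).condKernel x, inferInstance⟩
    ∂(π : Measure (X × X)).fst

/-- The weak transport cost `T_c(ν | μ)`: the infimum of `I_c[π]` over all couplings `π` of `μ`
and `ν`. -/
noncomputable def Tc (c : X → PGamma γ X → ℝ≥0∞) (ν μ : PGamma γ X) : ℝ≥0∞ :=
  ⨅ π : {π : ProbabilityMeasure (X × X) //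
      (π : Measure (X × X)).fst = μ.meas ∧ (π : Measure (X × X)).snd = ν.meas}, Ic c π.1

/-- For every `μ ∈ P_γ(X)`, `π ↦ I_c[π]` is lower semicontinuous on the set of those
`π ∈ P_γ(X × X)` whose first marginal is `μ`. -/
def CondC1 (c : X → PGamma γ X → ℝ≥0∞) : Prop :=
  ∀ μ : PGamma γ X, LowerSemicontinuousOn (fun π : PGammaPair γ X => Ic c π.toProb)
    {π | π.meas.fst = μ.meas}

/-- Condition (C). -/
def CondC (c : X → PGamma γ X → ℝ≥0∞) : Prop :=
  CondC1 c ∧ CondC2 c ∧ CondC3 c ∧ CondC4 c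

/-- Condition (C'). -/
def CondC' (c : X → PGamma γ X → ℝ≥0∞) : Prop :=
  CondC1 c ∧ CondC2 c ∧ CondC3' c ∧ CondC4 c

end Costs

/-- Condition (C''). -/
def CondC'' {X : Type*} [MetricSpace X] [MeasurableSpace X] {γ : ℝ≥0 → ℝ≥0}
    (c : X → PGamma γ X → ℝ≥0∞) : Prop :=
  CondC2 c ∧ CondC3'' c ∧ CondC4 c

end WeakTransport

namespace WeakTransport

open Filter Set

/-! Fix `μ`. The functional `F ν = T_c(ν | μ)` is convex and lower semicontinuous on `P_γ(X)`, so by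
Hahn–Banach it is the supremum of its affine minorants. The theorem identifies these with the dual
values, because `inf_ν {∫ φ dν + F ν}` is `∫ R_c φ dμ`: choosing `ν` together with a coupling
amounts to choosing a kernel `x ↦ p_x`, and the minimization can be done separately for each `x`.

Convexity (`IsControl.Tc_convex`) comes from mixing kernels. Lower semicontinuity
(`IsControl.lowerSemicontinuous_Tc`) comes from Prokhorov's theorem and (C₁): couplings with
convergent marginals are tight, and a weak limit of them is a limit in `P_γ(X × X)` because the
integral of `w x + w y` depends only on the marginals. In the discrete case (C₁) is not assumed but
proved (`IsControl.condC1_of_discrete`).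

A minorant `φ` (`IsControl.exists_affine_minorant`) need not be bounded below. Replacing it by `max
φ (-k)` raises `∫ φ dν'` for every `ν'`, and raises it at the given `ν` as little as desired for
large `k`.

The exchange of infimum and integral (`exists_lintegral_add_Tc_le`) needs measurable near-minimizers
`p_x`. Under (C) they are taken from a dense sequence of measures; under (C') `P_γ(X)` is a
continuous image of the Cantor set, where the least minimizer is measurable; under (C'') every map
is measurable. (C₄) then keeps `μ p` in `P_γ(X)`.

Since `γ` is only lower semicontinuous, a continuous control function `w` replaces the weights
throughout. -/

/-- A continuous function `w ≥ 1` that is comparable to `1 + W o` for every base point `o`. -/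
structure IsControl {B Y : Type*} [TopologicalSpace Y] (W : B → Y → ℝ≥0) (w : Y → ℝ) : Prop where
  cont : Continuous w
  one_le : ∀ y, 1 ≤ w y
  le : ∀ o, ∃ K : ℝ, 0 ≤ K ∧ ∀ y, (W o y : ℝ) ≤ K * w y
  ge : ∀ o, ∃ K : ℝ, 0 ≤ K ∧ ∀ y, w y ≤ K * (1 + (W o y : ℝ))

/-! ### Existence of a continuous control function -/

section Existence

variable {X : Type*} [MetricSpace X] {γ : ℝ≥0 → ℝ≥0}

lemma IsGrowthFunction.weight_le_of_dist_le (hγ : IsGrowthFunction γ) (r : ℝ≥0) :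
    ∃ K : ℝ≥0, ∀ o o' x x' : X, nndist o o' ≤ r → nndist x x' ≤ r →
      weight γ X o x ≤ K * (1 + weight γ X o' x') := by
  obtain ⟨K, hK⟩ := hγ.shift (r + r)
  refine ⟨K, fun o o' x x' ho hx => hK _ _ ?_⟩
  have h := dist_dist_dist_le x o x' o'
  have h1 : dist o o' ≤ r := by exact_mod_cast ho
  have h2 : dist x x' ≤ r := by exact_mod_cast hx
  have h3 : dist (nndist x o) (nndist x' o') ≤ r + r := by
    rw [NNReal.dist_eq]
    rw [Real.dist_eq] at h
    simpa using h.trans (by linarith)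
  exact_mod_cast h3

/-- The bounds required of `g` at `x` form a convex set, and by the shift property the constant
`weight γ X o x` satisfies them on the unit ball around `x`. A partition of unity glues these
constants into a continuous function. -/
lemma IsGrowthFunction.exists_isControl [Nonempty X] (hγ : IsGrowthFunction γ) :
    ∃ w, IsControl (weight γ X) w := by
  obtain ⟨o⟩ := ‹Nonempty X›
  obtain ⟨K, hK⟩ := hγ.weight_le_of_dist_le (X := X) 1
  let t : X → Set ℝ := fun x => Icc 0 (K * (1 + (weight γ X o x : ℝ))) ∩
    {s | (weight γ X o x : ℝ) ≤ K * (1 + s)}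
  have ht : ∀ x, Convex ℝ (t x) := fun x => by
    refine (convex_Icc _ _).inter ?_
    intro a ha b hb p q hp hq hpq
    simp only [mem_ofPred_eq, smul_eq_mul] at ha hb ⊢
    have : (K : ℝ) * (1 + (p * a + q * b)) = p * (K * (1 + a)) + q * (K * (1 + b)) := by
      linear_combination (-(K : ℝ)) * hpq
    rw [this]
    nlinarith [mul_le_mul_of_nonneg_left ha hp, mul_le_mul_of_nonneg_left hb hq]
  have key : ∀ x : X, ∃ s : ℝ, ∀ᶠ y in 𝓝 x, s ∈ t y := fun x => by
    refine ⟨weight γ X o x, ?_⟩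
    filter_upwards [Metric.closedBall_mem_nhds x one_pos] with y hy
    have hy' : nndist y x ≤ 1 := by
      rw [Metric.mem_closedBall] at hy; exact_mod_cast hy
    have h1 := hK o o y x (by simp) hy'
    have h2 := hK o o x y (by simp) (by rwa [nndist_comm])
    exact ⟨⟨by positivity, by exact_mod_cast h2⟩, by
      simp only [mem_ofPred_eq]; exact_mod_cast h1⟩
  obtain ⟨g, hg⟩ := exists_continuous_forall_mem_convex_of_local_const ht key
  refine ⟨fun x => 1 + g x, ⟨by fun_prop, fun y => by linarith [(hg y).1.1], fun o' => ?_,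
    fun o' => ?_⟩⟩
  · obtain ⟨L, hL⟩ := hγ.weight_le_of_dist_le (X := X) (nndist o' o)
    refine ⟨L * (1 + K), by positivity, fun y => ?_⟩
    have h1 : (weight γ X o' y : ℝ) ≤ L * (1 + weight γ X o y) := by
      exact_mod_cast hL o' o y y le_rfl (by simp)
    have h2 : (weight γ X o y : ℝ) ≤ K * (1 + g y) := (hg y).2
    have h3 := (hg y).1.1
    have hL0 := L.coe_nonneg
    nlinarith
  · obtain ⟨L, hL⟩ := hγ.weight_le_of_dist_le (X := X) (nndist o' o)
    refine ⟨1 + K * (1 + L), by positivity, fun y => ?_⟩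
    have h1 : (weight γ X o y : ℝ) ≤ L * (1 + weight γ X o' y) := by
      exact_mod_cast hL o o' y y (by rw [nndist_comm]) (by simp)
    have h2 : g y ≤ K * (1 + weight γ X o y) := (hg y).1.2
    have hK0 := K.coe_nonneg
    have hL0 := L.coe_nonneg
    have h3 := (weight γ X o' y).coe_nonneg
    nlinarith [mul_le_mul_of_nonneg_left h1 hK0]

lemma IsControl.pair {w : X → ℝ} (hw : IsControl (weight γ X) w) :
    IsControl (weightPair γ X) (fun z => w z.1 + w z.2) where
  cont := (hw.cont.comp continuous_fst).add (hw.cont.comp continuous_snd)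
  one_le z := by linarith [hw.one_le z.1, hw.one_le z.2]
  le o := by
    obtain ⟨K, hK0, hK⟩ := hw.le o
    refine ⟨K, hK0, fun z => ?_⟩
    have h1 := hK z.1
    have h2 := hK z.2
    simp only [weight] at h1 h2
    simp only [weightPair, NNReal.coe_add]
    linarith
  ge o := by
    obtain ⟨K, hK0, hK⟩ := hw.ge o
    refine ⟨2 * K, by positivity, fun z => ?_⟩
    have h1 := hK z.1
    have h2 := hK z.2
    simp only [weight] at h1 h2
    simp only [weightPair, NNReal.coe_add]
    have := mul_nonneg hK0 (γ (nndist z.1 o)).coe_nonneg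
    have := mul_nonneg hK0 (γ (nndist z.2 o)).coe_nonneg
    nlinarith

end Existence

/-! ### Growth classes in terms of a control function -/

section Growth

variable {B Y : Type*} [TopologicalSpace Y] {W : B → Y → ℝ≥0} {w : Y → ℝ}

lemma IsControl.nonneg (hw : IsControl W w) (y : Y) : 0 ≤ w y := zero_le_one.trans (hw.one_le y)

lemma IsControl.hasGrowth_iff [Nonempty B] (hw : IsControl W w) {φ : Y → ℝ} :
    HasGrowth W φ ↔ Continuous φ ∧ ∃ b : ℝ, 0 ≤ b ∧ ∀ y, |φ y| ≤ b * w y := by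
  constructor
  · rintro ⟨hc, o, a, b, ha, hb, h⟩
    obtain ⟨K, hK0, hK⟩ := hw.le o
    refine ⟨hc, a + b * K, by positivity, fun y => (h y).trans ?_⟩
    have h1 := hw.one_le y
    nlinarith [mul_le_mul_of_nonneg_left (hK y) hb]
  · rintro ⟨hc, b, hb, h⟩
    obtain ⟨o⟩ := ‹Nonempty B›
    obtain ⟨K, hK0, hK⟩ := hw.ge o
    refine ⟨hc, o, b * K, b * K, by positivity, by positivity, fun y => (h y).trans ?_⟩
    nlinarith [mul_le_mul_of_nonneg_left (hK y) hb]

lemma IsControl.hasGrowth [Nonempty B] (hw : IsControl W w) : HasGrowth W w :=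
  hw.hasGrowth_iff.2 ⟨hw.cont, 1, zero_le_one, fun y => by
    rw [abs_of_nonneg (hw.nonneg y), one_mul]⟩

lemma hasGrowth_of_bounded [Nonempty B] {φ : Y → ℝ} (hc : Continuous φ) {a : ℝ}
    (h : ∀ y, |φ y| ≤ a) : HasGrowth W φ := by
  obtain ⟨o⟩ := ‹Nonempty B›
  exact ⟨hc, o, |a|, 0, by positivity, le_rfl, fun y => by
    simpa using (h y).trans (le_abs_self a)⟩

lemma IsControl.hasGrowth_sum [Nonempty B] (hw : IsControl W w) {ι : Type*} (s : Finset ι) (a : ι → ℝ)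
    {φ : ι → Y → ℝ} (hφ : ∀ i, HasGrowth W (φ i)) :
    HasGrowth W fun y => ∑ i ∈ s, a i * φ i y := by
  choose hc b hb h using fun i => hw.hasGrowth_iff.1 (hφ i)
  refine hw.hasGrowth_iff.2 ⟨continuous_finsetSum _ fun i _ => continuous_const.mul (hc i),
    ∑ i ∈ s, |a i| * b i, Finset.sum_nonneg fun i _ => mul_nonneg (abs_nonneg _) (hb i),
    fun y => (Finset.abs_sum_le_sum_abs _ _).trans ?_⟩
  rw [Finset.sum_mul]
  refine Finset.sum_le_sum fun i _ => ?_
  rw [abs_mul, mul_assoc]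
  exact mul_le_mul_of_nonneg_left (h i y) (abs_nonneg _)

end Growth

/-! ### Topology, moments and integrability on weighted measures -/

section Control

variable {B Y : Type*} [MeasurableSpace Y] {W : B → Y → ℝ≥0} {w : Y → ℝ}

instance (p : WeightedProb W) : IsProbabilityMeasure p.meas :=
  inferInstanceAs (IsProbabilityMeasure (p.toProb : Measure Y))

lemma WeightedProb.meas_injective :
    Function.Injective (WeightedProb.meas : WeightedProb W → Measure Y) := by
  rintro ⟨p, hp⟩ ⟨q, hq⟩ h
  obtain rfl : p = q := Subtype.ext h
  rfl

lemma measurable_iff_meas {Z : Type*} [MeasurableSpace Z] {p : Z → WeightedProb W} :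
    Measurable p ↔ Measurable fun z => (p z).meas :=
  measurable_comap_iff

variable [TopologicalSpace Y]

lemma HasGrowth.continuous_integral {φ : Y → ℝ} (hφ : HasGrowth W φ) :
    Continuous fun p : WeightedProb W => ∫ y, φ y ∂p.meas :=
  continuous_iInf_dom (i := (⟨φ, hφ⟩ : {φ : Y → ℝ // HasGrowth W φ})) continuous_induced_dom

lemma tendsto_weightedProb_iff {ι : Type*} {l : Filter ι} {f : ι → WeightedProb W}
    {p : WeightedProb W} : Tendsto f l (𝓝 p) ↔
      ∀ φ, HasGrowth W φ → Tendsto (fun i => ∫ y, φ y ∂(f i).meas) l (𝓝 (∫ y, φ y ∂p.meas)) := by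
  rw [nhds_iInf, tendsto_iInf]
  simp only [nhds_induced, tendsto_comap_iff, Subtype.forall]
  rfl

lemma IsControl.hasMoment_iff [Nonempty B] (hw : IsControl W w) {m : Measure Y}
    [IsFiniteMeasure m] : HasMoment W m ↔ ∫⁻ y, ENNReal.ofReal (w y) ∂m < ∞ := by
  constructor
  · rintro ⟨o, ho⟩
    obtain ⟨K, hK0, hK⟩ := hw.ge o
    calc ∫⁻ y, ENNReal.ofReal (w y) ∂m
        ≤ ∫⁻ y, ENNReal.ofReal K * (1 + (W o y : ℝ≥0∞)) ∂m := by
          refine lintegral_mono fun y => (ENNReal.ofReal_le_ofReal (hK y)).trans_eq ?_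
          rw [ENNReal.ofReal_mul hK0, ENNReal.ofReal_add zero_le_one (by positivity)]
          simp
      _ = ENNReal.ofReal K * (m univ + ∫⁻ y, (W o y : ℝ≥0∞) ∂m) := by
          rw [lintegral_const_mul' _ _ ENNReal.ofReal_ne_top, lintegral_add_left measurable_const]
          simp
      _ < ∞ := ENNReal.mul_lt_top ENNReal.ofReal_lt_top
          (ENNReal.add_lt_top.2 ⟨measure_lt_top _ _, ho⟩)
  · intro h
    obtain ⟨o⟩ := ‹Nonempty B›
    obtain ⟨K, hK0, hK⟩ := hw.le o
    refine ⟨o, ?_⟩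
    calc ∫⁻ y, (W o y : ℝ≥0∞) ∂m ≤ ∫⁻ y, ENNReal.ofReal K * ENNReal.ofReal (w y) ∂m := by
          refine lintegral_mono fun y => ?_
          rw [← ENNReal.ofReal_mul hK0, ← ENNReal.ofReal_coe_nnreal]
          exact ENNReal.ofReal_le_ofReal (hK y)
      _ = ENNReal.ofReal K * ∫⁻ y, ENNReal.ofReal (w y) ∂m :=
          lintegral_const_mul' _ _ ENNReal.ofReal_ne_top
      _ < ∞ := ENNReal.mul_lt_top ENNReal.ofReal_lt_top h

lemma IsControl.lintegral_lt_top (hw : IsControl W w) (p : WeightedProb W) :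
    ∫⁻ y, ENNReal.ofReal (w y) ∂p.meas < ∞ :=
  have : Nonempty B := ⟨p.hasMoment.choose⟩
  hw.hasMoment_iff.1 p.hasMoment

variable [BorelSpace Y]

lemma IsControl.integrable (hw : IsControl W w) (p : WeightedProb W) : Integrable w p.meas :=
  ⟨hw.cont.measurable.aestronglyMeasurable, by
    rw [hasFiniteIntegral_iff_ofReal (.of_forall hw.nonneg)]
    exact hw.lintegral_lt_top p⟩

lemma IsControl.integrable_of_hasGrowth (hw : IsControl W w) {φ : Y → ℝ} (hφ : HasGrowth W φ)
    (p : WeightedProb W) : Integrable φ p.meas := by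
  have : Nonempty B := ⟨hφ.2.choose⟩
  obtain ⟨hc, b, hb, h⟩ := hw.hasGrowth_iff.1 hφ
  exact ((hw.integrable p).const_mul b).mono' hc.measurable.aestronglyMeasurable (.of_forall h)

lemma continuous_toProb [Nonempty B] :
    Continuous (WeightedProb.toProb : WeightedProb W → ProbabilityMeasure Y) := by
  rw [ProbabilityMeasure.continuous_iff_forall_continuous_integral]
  intro f
  exact (hasGrowth_of_bounded (W := W) f.continuous fun y =>
    (f.norm_coe_le_norm y)).continuous_integral

end Control

/-! ### Semicontinuity and convergence of integrals by approximation -/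

section Approximation

variable {ι Y : Type*} [MeasurableSpace Y]

/-- A supremum of continuous functionals is lower semicontinuous: one `f n` already has integral
above `s` at the limit measure, and `f n ≤ g`. -/
lemma eventually_lt_integral_of_monotone_approx {l : Filter ι} {m : ι → Measure Y} {m₀ : Measure Y}
    {g : Y → ℝ} {f : ℕ → Y → ℝ} (hg : ∀ i, Integrable g (m i)) (hg₀ : Integrable g m₀)
    (hf : ∀ n i, Integrable (f n) (m i)) (hf₀ : ∀ n, Integrable (f n) m₀)
    (hmono : ∀ y, Monotone fun n => f n y)
    (hlim : ∀ y, Tendsto (fun n => f n y) atTop (𝓝 (g y)))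
    (h : ∀ n, Tendsto (fun i => ∫ y, f n y ∂m i) l (𝓝 (∫ y, f n y ∂m₀)))
    {s : ℝ} (hs : s < ∫ y, g y ∂m₀) : ∀ᶠ i in l, s < ∫ y, g y ∂m i := by
  have h1 : Tendsto (fun n => ∫ y, f n y ∂m₀) atTop (𝓝 (∫ y, g y ∂m₀)) :=
    integral_tendsto_of_tendsto_of_monotone hf₀ hg₀ (.of_forall hmono) (.of_forall hlim)
  obtain ⟨n, hn⟩ := (h1.eventually_const_lt hs).exists
  filter_upwards [(h n).eventually_const_lt hn] with i hi
  exact hi.trans_le (integral_mono (hf n i) (hg i) fun y => (hmono y).ge_of_tendsto (hlim y) n)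

/-- Once `∫ V` converges, lower bounds for `V + φ` and `V - φ` bound `∫ φ` from below and from
above; half of the gap goes to each estimate. -/
lemma tendsto_integral_of_dominated_approx {l : Filter ι} {m : ι → Measure Y} {m₀ : Measure Y}
    {V φ : Y → ℝ} (hV : ∀ i, Integrable V (m i)) (hV₀ : Integrable V m₀)
    (hφ : ∀ i, Integrable φ (m i)) (hφ₀ : Integrable φ m₀)
    (hVlim : Tendsto (fun i => ∫ y, V y ∂m i) l (𝓝 (∫ y, V y ∂m₀)))
    (hadd : ∀ s < ∫ y, (V y + φ y) ∂m₀, ∀ᶠ i in l, s < ∫ y, (V y + φ y) ∂m i)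
    (hsub : ∀ s < ∫ y, (V y - φ y) ∂m₀, ∀ᶠ i in l, s < ∫ y, (V y - φ y) ∂m i) :
    Tendsto (fun i => ∫ y, φ y ∂m i) l (𝓝 (∫ y, φ y ∂m₀)) := by
  simp only [integral_add hV₀ hφ₀, integral_add (hV _) (hφ _), integral_sub hV₀ hφ₀,
    integral_sub (hV _) (hφ _)] at hadd hsub
  rw [tendsto_order] at hVlim ⊢
  constructor
  · intro a ha
    filter_upwards [hadd ((∫ y, V y ∂m₀) + (a + ∫ y, φ y ∂m₀) / 2) (by linarith),
      hVlim.2 ((∫ y, V y ∂m₀) + ((∫ y, φ y ∂m₀) - a) / 2) (by linarith)] with i h1 h2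
    linarith
  · intro a ha
    filter_upwards [hsub ((∫ y, V y ∂m₀) - (a + ∫ y, φ y ∂m₀) / 2) (by linarith),
      hVlim.2 ((∫ y, V y ∂m₀) + (a - ∫ y, φ y ∂m₀) / 2) (by linarith)] with i h1 h2
    linarith

end Approximation

/-! ### Convergence criteria and second countability of weighted measures -/

section SecondCountable

/-- In a separable metric space there is a countable family of bounded nonnegative continuous
functions such that every nonnegative continuous function is the limit of an increasing sequence
from the family. -/
lemma exists_countable_monotone_approx (Y : Type*) [MetricSpace Y] [SecondCountableTopology Y] :
    ∃ d : Finset (ℕ × ℕ × ℚ) → Y → ℝ, (∀ i, Continuous (d i)) ∧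
      (∀ i, ∃ a : ℝ, ∀ y, |d i y| ≤ a) ∧
      ∀ h : Y → ℝ, Continuous h → (∀ y, 0 ≤ h y) → ∃ e : ℕ → Finset (ℕ × ℕ × ℚ),
        (∀ y, Monotone fun n => d (e n) y) ∧
          ∀ y, Tendsto (fun n => d (e n) y) atTop (𝓝 (h y)) := by
  classical
  rcases isEmpty_or_nonempty Y with hY | hY
  · exact ⟨fun _ _ => 0, fun _ => continuous_const, fun _ => ⟨0, by simp⟩,
      fun h _ _ => ⟨fun _ => ∅, fun y => hY.elim y, fun y => hY.elim y⟩⟩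
  let u := TopologicalSpace.denseSeq Y
  -- Tents of rational height and integer slope centred at the dense points; the family consists of
  -- their finite suprema.
  let t : ℕ × ℕ × ℚ → Y → ℝ≥0 := fun j y => Real.toNNReal (j.2.2 - j.2.1 * dist y (u j.1))
  have htc : ∀ j, Continuous (t j) := fun j => by fun_prop
  have htb : ∀ j y, t j y ≤ Real.toNNReal j.2.2 := fun j y =>
    Real.toNNReal_le_toNNReal (by nlinarith [dist_nonneg (x := y) (y := u j.1),
      (Nat.cast_nonneg j.2.1 : (0 : ℝ) ≤ j.2.1)])
  let d : Finset (ℕ × ℕ × ℚ) → Y → ℝ := fun F y => ((F.sup fun j => t j y : ℝ≥0) : ℝ)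
  refine ⟨d, fun F => ?_, fun F => ⟨(F.sup fun j => Real.toNNReal j.2.2 : ℝ≥0), fun y => ?_⟩,
    fun h hc h0 => ?_⟩
  · exact NNReal.continuous_coe.comp (Continuous.finset_sup_apply fun j _ => htc j)
  · rw [abs_of_nonneg (NNReal.coe_nonneg _)]
    exact_mod_cast Finset.sup_mono_fun fun j _ => htb j y
  · obtain ⟨e, he⟩ := exists_surjective_nat (ℕ × ℕ × ℚ)
    let F : ℕ → Finset (ℕ × ℕ × ℚ) := fun n =>
      ((Finset.range n).image e).filter fun j => ∀ y, (t j y : ℝ) ≤ h y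
    have hF : Monotone F := fun a b hab => Finset.filter_subset_filter _
      (Finset.image_subset_image (Finset.range_mono hab))
    have hmono : ∀ y, Monotone fun n => d (F n) y := fun y a b hab => by
      exact_mod_cast Finset.sup_mono (f := fun j => t j y) (hF hab)
    have hle : ∀ n y, d (F n) y ≤ h y := fun n y => by
      have : (F n).sup (fun j => t j y) ≤ Real.toNNReal (h y) := Finset.sup_le fun j hj =>
        NNReal.le_toNNReal_of_coe_le ((Finset.mem_filter.1 hj).2 y)
      exact (NNReal.coe_le_coe.2 this).trans_eq (Real.coe_toNNReal _ (h0 y))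
    refine ⟨F, hmono, fun y => ?_⟩
    refine tendsto_order.2 ⟨fun s hs => ?_, fun s hs => .of_forall fun n => (hle n y).trans_lt hs⟩
    suffices ∃ j, (∀ z, (t j z : ℝ) ≤ h z) ∧ s < t j y by
      obtain ⟨j, hj, hjs⟩ := this
      obtain ⟨n, rfl⟩ := he j
      filter_upwards [eventually_gt_atTop n] with k hk
      refine hjs.trans_le (NNReal.coe_le_coe.2 (Finset.le_sup (f := fun j => t j y) ?_))
      exact Finset.mem_filter.2 ⟨Finset.mem_image_of_mem _ (Finset.mem_range.2 hk), hj⟩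
    rcases lt_or_ge s 0 with hs0 | hs0
    · refine ⟨(0, 0, 0), fun z => by simpa [t] using h0 z, hs0.trans_le (NNReal.coe_nonneg _)⟩
    obtain ⟨q', hq'⟩ := exists_rat_btwn hs
    obtain ⟨q, hq⟩ := exists_rat_btwn hq'.1
    obtain ⟨r, hr, hball⟩ := Metric.eventually_nhds_iff.1 (hc.continuousAt.eventually_const_lt hq'.2)
    -- The slope makes the tent vanish beyond distance `r / 2` from its centre. The centre is within
    -- `r / 2` of `y`, so the tent lives in the ball where `h > q'`, and within `(q - s) / k` of
    -- `y`, so its value at `y` exceeds `s`.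
    obtain ⟨k, hk⟩ := exists_nat_gt (q / (r / 2) : ℝ)
    have hq0 : (0 : ℝ) < q := hs0.trans_lt hq.1
    have hk0 : (0 : ℝ) < k := (div_pos hq0 (by positivity)).trans hk
    obtain ⟨i, hi⟩ := Metric.denseRange_iff.1 (TopologicalSpace.denseRange_denseSeq Y) y
      (min (r / 2) ((q - s) / k)) (lt_min (by positivity) (div_pos (by linarith [hq.1]) hk0))
    rw [lt_min_iff, lt_div_iff₀ hk0] at hi
    rw [div_lt_iff₀ (by positivity)] at hk
    refine ⟨(i, k, q), fun z => ?_, ?_⟩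
    · by_cases hz : dist z y < r
      · exact (NNReal.coe_le_coe.2 (htb _ z)).trans (by
          rw [Real.coe_toNNReal _ hq0.le]; linarith [hball hz, hq.2])
      · have h2 : r / 2 ≤ dist z (u i) := by
          have := dist_triangle z (u i) y
          rw [dist_comm (u i) y] at this
          linarith [hi.1]
        have : t (i, k, q) z = 0 := Real.toNNReal_of_nonpos (by
          simp only; nlinarith)
        rw [this]; exact h0 z
    · rw [Real.coe_toNNReal _ (by simp only; nlinarith [hi.2])]
      simp only
      nlinarith [hi.2]

variable {B Y : Type*} [Nonempty B] [MeasurableSpace Y] [MetricSpace Y]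
  [BorelSpace Y] {W : B → Y → ℝ≥0} {w : Y → ℝ}

/-- Any `φ` of controlled growth satisfies `|φ| ≤ b * w`, so `b * w ± φ` are nonnegative and the
lower bounds apply to both. -/
lemma IsControl.tendsto_of_eventually_lt (hw : IsControl W w) {ι : Type*} {l : Filter ι}
    {f : ι → WeightedProb W} {p : WeightedProb W}
    (hint : Tendsto (fun i => ∫ y, w y ∂(f i).meas) l (𝓝 (∫ y, w y ∂p.meas)))
    (hlow : ∀ g : Y → ℝ, HasGrowth W g → (∀ y, 0 ≤ g y) → ∀ s < ∫ y, g y ∂p.meas,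
      ∀ᶠ i in l, s < ∫ y, g y ∂(f i).meas) :
    Tendsto f l (𝓝 p) := by
  rw [tendsto_weightedProb_iff]
  intro φ hφ
  obtain ⟨hφc, b, hb, hφb⟩ := hw.hasGrowth_iff.1 hφ
  have hV : HasGrowth W fun y => b * w y := hw.hasGrowth_iff.2
    ⟨continuous_const.mul hw.cont, b, hb, fun y => by
      rw [abs_of_nonneg (mul_nonneg hb (hw.nonneg y))]⟩
  have hbd : ∀ y, |b * w y| + |φ y| ≤ 2 * b * w y := fun y => by
    rw [abs_of_nonneg (mul_nonneg hb (hw.nonneg y))]; linarith [hφb y]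
  refine tendsto_integral_of_dominated_approx
    (fun i => hw.integrable_of_hasGrowth hV _) (hw.integrable_of_hasGrowth hV p)
    (fun i => hw.integrable_of_hasGrowth hφ _) (hw.integrable_of_hasGrowth hφ p) ?_
    (hlow _ (hw.hasGrowth_iff.2 ⟨hV.1.add hφc, 2 * b, by positivity, fun y =>
      (abs_add_le _ _).trans (hbd y)⟩) fun y => by linarith [neg_le_of_abs_le (hφb y)])
    (hlow _ (hw.hasGrowth_iff.2 ⟨hV.1.sub hφc, 2 * b, by positivity, fun y =>
      (abs_sub _ _).trans (hbd y)⟩) fun y => by linarith [le_of_abs_le (hφb y)])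
  simp only [integral_const_mul]
  exact hint.const_mul b

/-- Weak convergence together with convergence of the integrals of a control function implies
convergence of the integrals of the functions of controlled growth. -/
lemma IsControl.tendsto_of_tendsto_toProb (hw : IsControl W w) {ι : Type*} {l : Filter ι}
    {f : ι → WeightedProb W} {p : WeightedProb W}
    (h : Tendsto (fun i => (f i).toProb) l (𝓝 p.toProb))
    (hint : Tendsto (fun i => ∫ y, w y ∂(f i).meas) l (𝓝 (∫ y, w y ∂p.meas))) :
    Tendsto f l (𝓝 p) := by
  rw [ProbabilityMeasure.tendsto_iff_forall_integral_tendsto] at h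
  have hlow : ∀ g : Y → ℝ, HasGrowth W g → (∀ y, 0 ≤ g y) → ∀ s < ∫ y, g y ∂p.meas,
      ∀ᶠ i in l, s < ∫ y, g y ∂(f i).meas := by
    intro g hg hg0 s hs
    have hbdd : ∀ (n : ℕ) y, ‖min (g y) n‖ ≤ n := fun n y => by
      rw [Real.norm_of_nonneg (le_min (hg0 y) n.cast_nonneg)]; exact min_le_right _ _
    have hcont : ∀ n : ℕ, Continuous fun y => min (g y) n := fun n => hg.1.min continuous_const
    have hgr : ∀ n : ℕ, HasGrowth W fun y => min (g y) n := fun n =>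
      hasGrowth_of_bounded (hcont n) (hbdd n)
    refine eventually_lt_integral_of_monotone_approx (f := fun (n : ℕ) y => min (g y) n)
      (fun i => hw.integrable_of_hasGrowth hg _) (hw.integrable_of_hasGrowth hg p)
      (fun n i => hw.integrable_of_hasGrowth (hgr n) _)
      (fun n => hw.integrable_of_hasGrowth (hgr n) p)
      (fun y a c hac => min_le_min_left _ (Nat.cast_le.2 hac)) (fun y => ?_)
      (fun n => h (BoundedContinuousFunction.ofNormedAddCommGroup _ (hcont n) n (hbdd n))) hs
    refine tendsto_const_nhds.congr' ?_
    filter_upwards [eventually_ge_atTop ⌈g y⌉₊] with n hn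
    exact (min_eq_left (Nat.ceil_le.1 hn)).symm
  exact hw.tendsto_of_eventually_lt hint hlow

/-- The integrals of `w` and of the countably many `w * d i` induce the topology: a nonnegative `g`
of controlled growth is `w * (g / w)`, and `g / w` is an increasing limit of functions `d i`. -/
lemma IsControl.secondCountableTopology [SecondCountableTopology Y] (hw : IsControl W w) :
    SecondCountableTopology (WeightedProb W) := by
  obtain ⟨d, hdc, hdb, hd⟩ := exists_countable_monotone_approx Y
  let ψ : Option (Finset (ℕ × ℕ × ℚ)) → Y → ℝ := fun o => o.elim w fun i y => w y * d i y
  have hψ : ∀ o, HasGrowth W (ψ o) := by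
    rintro (_ | i)
    · exact hw.hasGrowth
    · obtain ⟨a, ha⟩ := hdb i
      refine hw.hasGrowth_iff.2 ⟨hw.cont.mul (hdc i), |a|, abs_nonneg _, fun y => ?_⟩
      simp only [ψ, Option.elim, abs_mul, abs_of_nonneg (hw.nonneg y)]
      rw [mul_comm]
      exact mul_le_mul_of_nonneg_right ((ha y).trans (le_abs_self a)) (hw.nonneg y)
  let T : WeightedProb W → Option (Finset (ℕ × ℕ × ℚ)) → ℝ := fun p o => ∫ y, ψ o y ∂p.meas
  have hT : IsInducing T := by
    rw [isInducing_iff_nhds]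
    intro p
    refine le_antisymm ?_ ?_
    · exact (continuous_pi fun o => (hψ o).continuous_integral).continuousAt.le_comap
    · rw [← tendsto_id']
      have hlim : ∀ o, Tendsto (fun q : WeightedProb W => ∫ y, ψ o y ∂q.meas)
          (comap T (𝓝 (T p))) (𝓝 (∫ y, ψ o y ∂p.meas)) := fun o =>
        ((continuous_apply o).tendsto (T p)).comp tendsto_comap
      have hlow : ∀ g : Y → ℝ, HasGrowth W g → (∀ y, 0 ≤ g y) → ∀ s < ∫ y, g y ∂p.meas,
          ∀ᶠ q : WeightedProb W in comap T (𝓝 (T p)), s < ∫ y, g y ∂q.meas := by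
        intro g hg hg0 s hs
        have hwpos : ∀ y, w y ≠ 0 := fun y => (zero_lt_one.trans_le (hw.one_le y)).ne'
        obtain ⟨e, he1, he2⟩ := hd (fun y => g y / w y) (hg.1.div hw.cont hwpos)
          fun y => div_nonneg (hg0 y) (hw.nonneg y)
        refine eventually_lt_integral_of_monotone_approx (f := fun n => ψ (some (e n)))
          (fun q => hw.integrable_of_hasGrowth hg q) (hw.integrable_of_hasGrowth hg p)
          (fun n q => hw.integrable_of_hasGrowth (hψ _) q)
          (fun n => hw.integrable_of_hasGrowth (hψ _) p)
          (fun y a c hac => mul_le_mul_of_nonneg_left (he1 y hac) (hw.nonneg y))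
          (fun y => ?_) (fun n => hlim _) hs
        have := (he2 y).const_mul (w y)
        rwa [mul_div_cancel₀ _ (hwpos y)] at this
      exact hw.tendsto_of_eventually_lt (hlim none) hlow
  exact hT.secondCountableTopology

end SecondCountable

lemma IsControl.exists_convex_combination {B Y : Type*} [Nonempty B] [MeasurableSpace Y]
    [TopologicalSpace Y] {W : B → Y → ℝ≥0} {w : Y → ℝ} (hw : IsControl W w)
    {s t : ℝ≥0} (hst : s + t = 1) (p q : WeightedProb W) :
    ∃ r : WeightedProb W, r.meas = s • p.meas + t • q.meas := by
  have hprob : IsProbabilityMeasure (s • p.meas + t • q.meas) := ⟨by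
    simp only [Measure.coe_add, Measure.coe_nnreal_smul_apply, Pi.add_apply, measure_univ, mul_one]
    exact_mod_cast hst⟩
  have hmom : HasMoment W (s • p.meas + t • q.meas) := by
    rw [hw.hasMoment_iff, lintegral_add_measure, lintegral_smul_measure, lintegral_smul_measure]
    exact ENNReal.add_lt_top.2 ⟨ENNReal.mul_lt_top ENNReal.coe_lt_top (hw.lintegral_lt_top p),
      ENNReal.mul_lt_top ENNReal.coe_lt_top (hw.lintegral_lt_top q)⟩
  exact ⟨⟨⟨_, hprob⟩, hmom⟩, rfl⟩

/-! ### Couplings as kernels, and convexity of the transport cost -/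

section Kernel

variable {X : Type*} [MetricSpace X] [MeasurableSpace X] {γ : ℝ≥0 → ℝ≥0}

instance [BorelSpace X] [Nonempty X] : Nonempty (PGamma γ X) := by
  obtain ⟨x⟩ := ‹Nonempty X›
  exact ⟨⟨⟨Measure.dirac x, inferInstance⟩, x, by simp [lintegral_dirac]⟩⟩

/-- The Markov kernel associated with a measurable map to `P_γ(X)`. -/
noncomputable def toKernel (p : X → PGamma γ X) (hp : Measurable p) : Kernel X X :=
  ⟨fun x => (p x).meas, measurable_iff_meas.1 hp⟩

instance (p : X → PGamma γ X) (hp : Measurable p) : IsMarkovKernel (toKernel p hp) :=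
  ⟨fun x => inferInstanceAs (IsProbabilityMeasure (p x).meas)⟩

lemma extendCost_of_eq {c : X → PGamma γ X → ℝ≥0∞} {x : X} {m : ProbabilityMeasure X}
    {p : PGamma γ X} (h : (m : Measure X) = p.meas) : extendCost c x m = c x p := by
  have hm : HasMoment (weight γ X) (m : Measure X) := h ▸ p.hasMoment
  rw [extendCost, dif_pos hm]
  congr 1
  exact WeightedProb.meas_injective h

lemma measurable_cost {c : X → PGamma γ X → ℝ≥0∞} (hc : Measurable (Function.uncurry c))
    {p : X → PGamma γ X} (hp : Measurable p) : Measurable fun x => c x (p x) :=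
  hc.comp (measurable_id.prodMk hp)

variable [BorelSpace X] [CompleteSpace X] [SecondCountableTopology X] [Nonempty X]
  {c : X → PGamma γ X → ℝ≥0∞}

lemma Tc_le_of_kernel {μ ν : PGamma γ X} {p : X → PGamma γ X} (hp : Measurable p)
    (hν : μ.meas.bind (fun x => (p x).meas) = ν.meas) :
    Tc c ν μ ≤ ∫⁻ x, c x (p x) ∂μ.meas := by
  let κ := toKernel p hp
  let π : ProbabilityMeasure (X × X) := ⟨μ.meas ⊗ₘ κ, inferInstance⟩
  have h1 : (π : Measure (X × X)).fst = μ.meas := Measure.fst_compProd _ _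
  have h2 : (π : Measure (X × X)).snd = ν.meas := (Measure.snd_compProd _ _).trans hν
  refine (iInf_le _ ⟨π, h1, h2⟩).trans_eq ?_
  simp only [Ic, h1]
  refine lintegral_congr_ae ?_
  filter_upwards [condKernel_compProd μ.meas κ] with x hx
  exact extendCost_of_eq hx

/-- Since `ν` integrates `w`, so does almost every conditional measure of `π`; on the exceptional
null set a fixed element of `P_γ(X)` is substituted. -/
lemma IsControl.exists_kernel {w : X → ℝ} (hw : IsControl (weight γ X) w) {μ ν : PGamma γ X}
    {π : ProbabilityMeasure (X × X)} (h1 : (π : Measure (X × X)).fst = μ.meas)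
    (h2 : (π : Measure (X × X)).snd = ν.meas) :
    ∃ p : X → PGamma γ X, Measurable p ∧ μ.meas.bind (fun x => (p x).meas) = ν.meas ∧
      (∀ᵐ x ∂μ.meas, (π : Measure (X × X)).condKernel x = (p x).meas) ∧
      Ic c π = ∫⁻ x, c x (p x) ∂μ.meas := by
  classical
  set κ := (π : Measure (X × X)).condKernel with hκ
  have hdis : μ.meas ⊗ₘ κ = π := by rw [← h1]; exact Measure.disintegrate _ _
  have hbind : μ.meas.bind κ = ν.meas := by
    rw [← h2, ← hdis]; exact (Measure.snd_compProd _ _).symm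
  have hwm : Measurable fun y => ENNReal.ofReal (w y) := hw.cont.measurable.ennreal_ofReal
  let S : Set X := {x | ∫⁻ y, ENNReal.ofReal (w y) ∂κ x < ∞}
  have hS : MeasurableSet S := measurableSet_lt hwm.lintegral_kernel measurable_const
  have hSmom : ∀ x, x ∈ S → HasMoment (weight γ X) (κ x) := fun x hx => hw.hasMoment_iff.2 hx
  have hSae : ∀ᵐ x ∂μ.meas, x ∈ S := by
    refine ae_lt_top hwm.lintegral_kernel ?_
    rw [← Measure.lintegral_bind κ.aemeasurable hwm.aemeasurable, hbind]
    exact (hw.lintegral_lt_top ν).ne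
  obtain ⟨p₀⟩ : Nonempty (PGamma γ X) := inferInstance
  let p : X → PGamma γ X := fun x =>
    if hx : x ∈ S then ⟨⟨κ x, inferInstance⟩, hSmom x hx⟩ else p₀
  have hpS : ∀ x ∈ S, (p x).meas = κ x := fun x hx => by simp only [p, dif_pos hx]; rfl
  have hpae : ∀ᵐ x ∂μ.meas, κ x = (p x).meas := by
    filter_upwards [hSae] with x hx using (hpS x hx).symm
  have hpm : Measurable p := by
    rw [measurable_iff_meas]
    have : (fun x => (p x).meas) = S.piecewise κ fun _ => p₀.meas := by
      funext x
      by_cases hx : x ∈ S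
      · rw [Set.piecewise_eq_of_mem _ _ _ hx, hpS x hx]
      · rw [Set.piecewise_eq_of_notMem _ _ _ hx]
        simp only [p, dif_neg hx]
    rw [this]
    exact κ.measurable.piecewise hS measurable_const
  refine ⟨p, hpm, ?_, hpae, ?_⟩
  · rw [← hbind]
    refine Measure.bind_congr_right ?_
    filter_upwards [hpae] with x hx using hx.symm
  · simp only [Ic, h1]
    refine lintegral_congr_ae ?_
    filter_upwards [hpae] with x hx
    exact extendCost_of_eq hx

lemma IsControl.exists_kernel_of_Tc_lt {w : X → ℝ} (hw : IsControl (weight γ X) w)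
    {μ ν : PGamma γ X} {a : ℝ≥0∞} (h : Tc c ν μ < a) :
    ∃ p : X → PGamma γ X, Measurable p ∧ μ.meas.bind (fun x => (p x).meas) = ν.meas ∧
      ∫⁻ x, c x (p x) ∂μ.meas < a := by
  obtain ⟨⟨π, h1, h2⟩, hπ⟩ := iInf_lt_iff.1 h
  obtain ⟨p, hp, hb, -, hI⟩ := hw.exists_kernel (c := c) h1 h2
  exact ⟨p, hp, hb, hI ▸ hπ⟩

/-- The transport cost `ν ↦ T_c(ν | μ)` is convex. -/
lemma IsControl.Tc_convex {w : X → ℝ} (hw : IsControl (weight γ X) w)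
    (hc : Measurable (Function.uncurry c)) (hc2 : CondC2 c) (μ : PGamma γ X)
    {ν₁ ν₂ ν : PGamma γ X} {s t : ℝ≥0} (hst : s + t = 1)
    (hν : ν.meas = s • ν₁.meas + t • ν₂.meas) :
    Tc c ν μ ≤ s * Tc c ν₁ μ + t * Tc c ν₂ μ := by
  -- Near-optimal kernels for `ν₁` and `ν₂` are mixed pointwise, and (C₂) is applied for each `x`.
  have key : ∀ a b : ℝ≥0∞, Tc c ν₁ μ < a → Tc c ν₂ μ < b → Tc c ν μ ≤ s * a + t * b := by
    intro a b ha hb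
    obtain ⟨p, hp, hpb, hpa⟩ := hw.exists_kernel_of_Tc_lt ha
    obtain ⟨q, hq, hqb, hqa⟩ := hw.exists_kernel_of_Tc_lt hb
    choose r hr using fun x => hw.exists_convex_combination hst (p x) (q x)
    have hpm := measurable_iff_meas.1 hp
    have hqm := measurable_iff_meas.1 hq
    have hrm : Measurable r := by
      rw [measurable_iff_meas]
      simp only [hr]
      refine Measure.measurable_of_measurable_coe _ fun A hA => ?_
      simp only [Measure.coe_add, Measure.coe_nnreal_smul_apply, Pi.add_apply]
      exact (((Measure.measurable_coe hA).comp hpm).const_mul _).add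
        (((Measure.measurable_coe hA).comp hqm).const_mul _)
    have hrb : μ.meas.bind (fun x => (r x).meas) = ν.meas := by
      rw [hν, ← hpb, ← hqb]
      ext A hA
      have hpA : Measurable fun x => (p x).meas A := (Measure.measurable_coe hA).comp hpm
      have hqA : Measurable fun x => (q x).meas A := (Measure.measurable_coe hA).comp hqm
      simp only [Measure.coe_add, Measure.coe_nnreal_smul_apply, Pi.add_apply]
      rw [Measure.bind_apply hA (measurable_iff_meas.1 hrm).aemeasurable,
        Measure.bind_apply hA hpm.aemeasurable, Measure.bind_apply hA hqm.aemeasurable]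
      simp only [hr, Measure.coe_add, Measure.coe_nnreal_smul_apply, Pi.add_apply]
      rw [lintegral_add_left (hpA.const_mul _), lintegral_const_mul _ hpA,
        lintegral_const_mul _ hqA]
    calc Tc c ν μ ≤ ∫⁻ x, c x (r x) ∂μ.meas := Tc_le_of_kernel hrm hrb
      _ ≤ ∫⁻ x, (s * c x (p x) + t * c x (q x)) ∂μ.meas :=
          lintegral_mono fun x => hc2 x (p x) (q x) (r x) s t hst (hr x)
      _ = s * ∫⁻ x, c x (p x) ∂μ.meas + t * ∫⁻ x, c x (q x) ∂μ.meas := by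
          rw [lintegral_add_left ((measurable_cost hc hp).const_mul _),
            lintegral_const_mul _ (measurable_cost hc hp),
            lintegral_const_mul _ (measurable_cost hc hq)]
      _ ≤ s * a + t * b := by gcongr
  -- With a zero coefficient the other cost may be infinite, and then no strict upper bound exists
  -- to feed `key`.
  rcases eq_or_ne s 0 with rfl | hs
  · obtain rfl : t = 1 := by simpa using hst
    rw [WeightedProb.meas_injective (by simpa using hν : ν.meas = ν₂.meas)]
    simp
  rcases eq_or_ne t 0 with rfl | ht
  · obtain rfl : s = 1 := by simpa using hst
    rw [WeightedProb.meas_injective (by simpa using hν : ν.meas = ν₁.meas)]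
    simp
  rcases eq_or_ne (Tc c ν₁ μ) ∞ with h1 | h1
  · simp [h1, ENNReal.mul_top, hs]
  rcases eq_or_ne (Tc c ν₂ μ) ∞ with h2 | h2
  · simp [h2, ENNReal.mul_top, ht]
  refine ENNReal.le_of_forall_pos_le_add fun ε hε _ => ?_
  have hε' : (ε : ℝ≥0∞) ≠ 0 := by exact_mod_cast hε.ne'
  refine (key _ _ (ENNReal.lt_add_right h1 hε') (ENNReal.lt_add_right h2 hε')).trans_eq ?_
  have : (s : ℝ≥0∞) + t = 1 := by exact_mod_cast hst
  calc (s : ℝ≥0∞) * (Tc c ν₁ μ + ε) + t * (Tc c ν₂ μ + ε)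
      = s * Tc c ν₁ μ + t * Tc c ν₂ μ + (s + t) * ε := by ring
    _ = _ := by rw [this, one_mul]

end Kernel

/-! ### Lower semicontinuity of the transport cost -/

section Semicontinuity

variable {X : Type*} [MetricSpace X] [MeasurableSpace X] {γ : ℝ≥0 → ℝ≥0} [BorelSpace X]
  {w : X → ℝ}

lemma lintegral_control_pair {π : Measure (X × X)} (hw : IsControl (weight γ X) w) :
    ∫⁻ z, ENNReal.ofReal (w z.1 + w z.2) ∂π =
      ∫⁻ x, ENNReal.ofReal (w x) ∂π.fst + ∫⁻ x, ENNReal.ofReal (w x) ∂π.snd := by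
  have hwm : Measurable fun y => ENNReal.ofReal (w y) := hw.cont.measurable.ennreal_ofReal
  have hwm1 : Measurable fun z : X × X => ENNReal.ofReal (w z.1) := hwm.comp measurable_fst
  rw [Measure.fst, Measure.snd, lintegral_map hwm measurable_fst,
    lintegral_map hwm measurable_snd,  ← lintegral_add_left hwm1]
  exact lintegral_congr fun z => ENNReal.ofReal_add (hw.nonneg _) (hw.nonneg _)

lemma IsControl.integral_pair (hw : IsControl (weight γ X) w) {μ ν : PGamma γ X}
    {ρ : PGammaPair γ X} (h1 : ρ.meas.fst = μ.meas) (h2 : ρ.meas.snd = ν.meas) :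
    ∫ z, (w z.1 + w z.2) ∂ρ.meas = ∫ x, w x ∂μ.meas + ∫ x, w x ∂ν.meas := by
  have hwm {m : Measure X} : AEStronglyMeasurable w m := hw.cont.measurable.aestronglyMeasurable
  have i1 : Integrable (fun z : X × X => w z.1) ρ.meas := by
    have := hw.integrable μ
    rw [← h1] at this
    exact this.comp_measurable measurable_fst
  have i2 : Integrable (fun z : X × X => w z.2) ρ.meas := by
    have := hw.integrable ν
    rw [← h2] at this
    exact this.comp_measurable measurable_snd
  rw [integral_add i1 i2, ← h1, ← h2, Measure.fst, Measure.snd,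
    integral_map measurable_fst.aemeasurable hwm, integral_map measurable_snd.aemeasurable hwm]

variable [Nonempty X]

lemma IsControl.exists_pair (hw : IsControl (weight γ X) w) {μ ν : PGamma γ X}
    (π : ProbabilityMeasure (X × X)) (h1 : (π : Measure (X × X)).fst = μ.meas)
    (h2 : (π : Measure (X × X)).snd = ν.meas) :
    ∃ ρ : PGammaPair γ X, ρ.toProb = π := by
  refine ⟨⟨π, hw.pair.hasMoment_iff.2 ?_⟩, rfl⟩
  rw [lintegral_control_pair hw, h1, h2]
  exact ENNReal.add_lt_top.2 ⟨hw.lintegral_lt_top _, hw.lintegral_lt_top _⟩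

lemma continuous_weightedProb_iff {B Y Z : Type*} [MeasurableSpace Y] [TopologicalSpace Y]
    [TopologicalSpace Z] {W : B → Y → ℝ≥0} {f : Z → WeightedProb W} :
    Continuous f ↔ ∀ φ, HasGrowth W φ → Continuous fun z => ∫ y, φ y ∂(f z).meas := by
  simp only [continuous_iff_continuousAt, ContinuousAt, tendsto_weightedProb_iff]
  exact ⟨fun h φ hφ z => h z φ hφ, fun h z φ hφ => h φ hφ z⟩

variable [SecondCountableTopology X] [CompleteSpace X] {c : X → PGamma γ X → ℝ≥0∞}

/-- The transport cost `ν ↦ T_c(ν | μ)` is lower semicontinuous. -/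
lemma IsControl.lowerSemicontinuous_Tc (hw : IsControl (weight γ X) w) (hc1 : CondC1 c)
    (μ : PGamma γ X) : LowerSemicontinuous fun ν => Tc c ν μ := by
  have := hw.secondCountableTopology
  intro ν₀ t ht
  by_contra hcon
  obtain ⟨t', htt', ht'⟩ := exists_between ht
  -- Second countability permits sequences; a convergent sequence with its limit is compact, which
  -- yields tightness of the second marginals.
  obtain ⟨ν, hν, hνt⟩ := exists_seq_forall_of_frequently (not_eventually.1 hcon)
  have hex : ∀ n, ∃ π : ProbabilityMeasure (X × X), (π : Measure (X × X)).fst = μ.meas ∧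
      (π : Measure (X × X)).snd = (ν n).meas ∧ Ic c π < t' := fun n => by
    obtain ⟨⟨π, h1, h2⟩, hπ⟩ := iInf_lt_iff.1 ((not_lt.1 (hνt n)).trans_lt htt')
    exact ⟨π, h1, h2, hπ⟩
  choose π hπ1 hπ2 hπt using hex
  have hνprob : Tendsto (fun n => (ν n).toProb) atTop (𝓝 ν₀.toProb) :=
    (continuous_toProb.tendsto ν₀).comp hν
  have htight : IsTightMeasureSet {((ρ : ProbabilityMeasure (X × X)) : Measure (X × X)) |
      ρ ∈ range π} := by
    refine IsTightMeasureSet.prodMk ?_ ?_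
    · refine (isTightMeasureSet_singleton (μ := μ.meas)).subset ?_
      rintro _ ⟨_, ⟨_, ⟨n, rfl⟩, rfl⟩, rfl⟩
      exact hπ1 n
    · have hcpt : IsCompact (closure (range fun n => (ν n).toProb)) :=
        hνprob.isCompact_insert_range.closure_of_subset (subset_insert _ _)
      refine (isTightMeasureSet_of_isCompact_closure hcpt).subset ?_
      rintro _ ⟨_, ⟨_, ⟨n, rfl⟩, rfl⟩, rfl⟩
      exact ⟨_, ⟨n, rfl⟩, (hπ2 n).symm⟩
  -- A free ultrafilter plays the role of a convergent subsequence.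
  let U : Ultrafilter ℕ := hyperfilter ℕ
  have hU : (U : Filter ℕ) ≤ atTop := Nat.hyperfilter_le_atTop
  obtain ⟨π₀, -, hπ₀⟩ := (isCompact_closure_of_isTightMeasureSet htight).ultrafilter_le_nhds
    (U.map π) (by
      rw [le_principal_iff]
      exact Ultrafilter.mem_map.2 (univ_mem' fun n => subset_closure (mem_range_self n)))
  have hlim : Tendsto π U (𝓝 π₀) := hπ₀
  have hfst : (π₀ : Measure (X × X)).fst = μ.meas := by
    have h1 := ((ProbabilityMeasure.continuous_map continuous_fst).tendsto π₀).comp hlim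
    have h2 : ∀ n, (π n).map continuous_fst.aemeasurable = μ.toProb := fun n =>
      Subtype.ext (hπ1 n)
    simp only [Function.comp_def, h2] at h1
    exact (congrArg ((↑) : ProbabilityMeasure X → Measure X)
      (tendsto_nhds_unique tendsto_const_nhds h1)).symm
  have hsnd : (π₀ : Measure (X × X)).snd = ν₀.meas := by
    have h1 := ((ProbabilityMeasure.continuous_map continuous_snd).tendsto π₀).comp hlim
    have h2 : ∀ n, (π n).map continuous_snd.aemeasurable = (ν n).toProb := fun n =>
      Subtype.ext (hπ2 n)
    simp only [Function.comp_def, h2] at h1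
    exact (congrArg ((↑) : ProbabilityMeasure X → Measure X)
      (tendsto_nhds_unique (hνprob.mono_left hU) h1)).symm
  choose ρ hρ using fun n => hw.exists_pair (π n) (hπ1 n) (hπ2 n)
  obtain ⟨ρ₀, hρ₀⟩ := hw.exists_pair π₀ hfst hsnd
  have hρ1 : ∀ n, (ρ n).meas.fst = μ.meas := fun n => by rw [← hπ1 n, ← hρ n]; rfl
  have hρ2 : ∀ n, (ρ n).meas.snd = (ν n).meas := fun n => by rw [← hπ2 n, ← hρ n]; rfl
  have hρ₀1 : ρ₀.meas.fst = μ.meas := by rw [← hfst, ← hρ₀]; rfl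
  have hρ₀2 : ρ₀.meas.snd = ν₀.meas := by rw [← hsnd, ← hρ₀]; rfl
  have hρlim : Tendsto ρ U (𝓝 ρ₀) := by
    refine hw.pair.tendsto_of_tendsto_toProb (by simpa only [hρ, hρ₀] using hlim) ?_
    simp only [hw.integral_pair (hρ1 _) (hρ2 _), hw.integral_pair hρ₀1 hρ₀2]
    exact ((hw.hasGrowth.continuous_integral.tendsto ν₀).comp (hν.mono_left hU)).const_add _
  have hlt : t' < Ic c ρ₀.toProb := by
    rw [hρ₀]
    exact ht'.trans_le (iInf_le (fun π : {π : ProbabilityMeasure (X × X) //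
      (π : Measure (X × X)).fst = μ.meas ∧ (π : Measure (X × X)).snd = ν₀.meas} => Ic c π.1)
      ⟨π₀, hfst, hsnd⟩)
  have hev := (tendsto_nhdsWithin_iff.2 ⟨hρlim, .of_forall hρ1⟩).eventually (hc1 μ ρ₀ hρ₀1 t' hlt)
  obtain ⟨n, hn⟩ := hev.exists
  exact lt_asymm (hρ n ▸ hn : t' < Ic c (π n)) (hπt n)

/-- Here `Ic` is a countable sum of terms `c x π_x * μ {x}`. At an atom `x` of `μ`, `π_x` is the
normalized restriction of `π` to the fibre over `x`; this depends continuously on `π` because the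
fibre is clopen. Points of zero mass contribute nothing. -/
lemma IsControl.condC1_of_discrete (hw : IsControl (weight γ X) w) (hc3 : CondC3'' c) :
    CondC1 c := by
  obtain ⟨hX, hdisc, hlsc⟩ := hc3
  intro μ
  let S : Set (PGammaPair γ X) := {π | π.meas.fst = μ.meas}
  let k : S → X → ProbabilityMeasure X := fun π x => ⟨π.1.meas.condKernel x, inferInstance⟩
  have hI : S.domRestrict (fun π : PGammaPair γ X => Ic c π.toProb) =
      fun π : S => ∑' x, extendCost c x (k π x) * μ.meas {x} := by
    funext π
    have h1 : (π.1.toProb : Measure (X × X)).fst = μ.meas := π.2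
    change ∫⁻ x, extendCost c x (k π x) ∂(π.1.toProb : Measure (X × X)).fst = _
    rw [h1]
    exact lintegral_countable' (α := X) _
  refine (lowerSemicontinuous_restrict_iff (s := S)).1 ?_
  rw [hI]
  refine lowerSemicontinuous_tsum fun x => ?_
  rcases eq_or_ne (μ.meas {x}) 0 with hx | hx
  · simp only [hx, mul_zero]
    exact lowerSemicontinuous_const
  have hk : ∀ π : S, (k π x : Measure X) =
      (μ.meas {x})⁻¹ • (π.1.meas.restrict (Prod.fst ⁻¹' {x})).map Prod.snd := fun π => by
    have hx' : π.1.meas.fst {x} ≠ 0 := by rwa [show π.1.meas.fst = μ.meas from π.2]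
    ext A hA
    have h1 : (k π x : Measure X) A = _ := Measure.condKernel_apply_of_ne_zero hx' A
    rw [h1, Measure.smul_apply, Measure.map_apply measurable_snd hA,
      Measure.restrict_apply (measurable_snd hA), show π.1.meas.fst = μ.meas from π.2]
    congr 2
    ext z
    simp [and_comm]
  have hinv : (μ.meas {x})⁻¹ ≠ ∞ := ENNReal.inv_ne_top.2 hx
  have hwm : Measurable fun y => ENNReal.ofReal (w y) := hw.cont.measurable.ennreal_ofReal
  have hmom : ∀ π : S, HasMoment (weight γ X) (k π x : Measure X) := fun π => by
    rw [hw.hasMoment_iff, hk, lintegral_smul_measure, lintegral_map hwm measurable_snd]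
    refine ENNReal.mul_lt_top hinv.lt_top ?_
    refine lt_of_le_of_lt ((setLIntegral_le_lintegral _ _).trans (lintegral_mono fun z => ?_))
      (hw.pair.lintegral_lt_top π.1)
    exact ENNReal.ofReal_le_ofReal (by linarith [hw.nonneg z.1])
  let P : S → PGamma γ X := fun π => ⟨k π x, hmom π⟩
  have hP : Continuous P := by
    rw [continuous_weightedProb_iff]
    intro φ hφ
    have hmx : MeasurableSet (Prod.fst ⁻¹' {x} : Set (X × X)) :=
      measurable_fst (measurableSet_singleton x)
    have heq : ∀ π : S, ∫ y, φ y ∂(P π).meas = (μ.meas {x})⁻¹.toReal *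
        ∫ z, (Prod.fst ⁻¹' {x} : Set (X × X)).indicator (fun z => φ z.2) z ∂π.1.meas := fun π => by
      have : (P π).meas = _ := hk π
      rw [this, integral_smul_measure, integral_map measurable_snd.aemeasurable
        hφ.1.measurable.aestronglyMeasurable, integral_indicator hmx, smul_eq_mul]
    simp only [heq]
    obtain ⟨hφc, b, hb, hφb⟩ := hw.hasGrowth_iff.1 hφ
    have hgr : HasGrowth (weightPair γ X)
        ((Prod.fst ⁻¹' {x} : Set (X × X)).indicator fun z => φ z.2) := by
      refine hw.pair.hasGrowth_iff.2 ⟨?_, b, hb, fun z => ?_⟩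
      · exact (hφc.comp continuous_snd).indicator fun z hz => by
          rw [((isClopen_discrete {x}).preimage continuous_fst).frontier_eq] at hz
          exact hz.elim
      · refine (norm_indicator_le_norm_self (fun z : X × X => φ z.2) z).trans ((hφb z.2).trans ?_)
        exact mul_le_mul_of_nonneg_left (by linarith [hw.nonneg z.1]) hb
    exact (hgr.continuous_integral.comp continuous_subtype_val).const_mul _
  have hterm : (fun π : S => extendCost c x (k π x) * μ.meas {x}) =
      fun π => c x (P π) * μ.meas {x} := by
    funext π
    rw [extendCost_of_eq (p := P π) rfl]
  rw [hterm]
  exact (ENNReal.continuous_mul_const (measure_ne_top _ _)).comp_lowerSemicontinuous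
    (LowerSemicontinuous.comp (hlsc x) hP) fun a b hab => mul_le_mul_left hab _

end Semicontinuity

/-! ### Affine minorants of convex lower semicontinuous functionals -/

section Duality

variable {B Y : Type*} [MeasurableSpace Y] [TopologicalSpace Y] {W : B → Y → ℝ≥0} {w : Y → ℝ}

/-- Basic neighbourhoods involve finitely many integrals, so the separation argument can take place
in a finite-dimensional space. -/
lemma exists_finite_nhds_weightedProb {ν₀ : WeightedProb W} {S : Set (WeightedProb W)}
    (hS : S ∈ 𝓝 ν₀) : ∃ I : Set {φ : Y → ℝ // HasGrowth W φ}, I.Finite ∧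
      ∃ ε : {φ : Y → ℝ // HasGrowth W φ} → ℝ, (∀ i, 0 < ε i) ∧ ∀ ν : WeightedProb W,
        (∀ i ∈ I, ∫ y, i.1 y ∂ν.meas ∈ Metric.ball (∫ y, i.1 y ∂ν₀.meas) (ε i)) → ν ∈ S := by
  have hind : IsInducing fun (ν : WeightedProb W) (i : {φ : Y → ℝ // HasGrowth W φ}) =>
      ∫ y, i.1 y ∂ν.meas := inducing_iInf_to_pi _
  rw [hind.nhds_eq_comap, nhds_pi, mem_comap] at hS
  obtain ⟨U, hU, hUS⟩ := hS
  obtain ⟨I, hI, t, ht, hIt⟩ := Filter.mem_pi.1 hU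
  choose ε hε hεt using fun i => Metric.mem_nhds_iff.1 (ht i)
  exact ⟨I, hI, ε, hε, fun ν hν => hUS (hIt fun i hi => hεt i (hν i hi))⟩

variable [Nonempty B] [BorelSpace Y]

/-- A convex lower semicontinuous function with values in `[0, ∞]` is approximated from below by
affine functions. -/
lemma IsControl.exists_affine_minorant (hw : IsControl W w) {F : WeightedProb W → ℝ≥0∞}
    (hconv : ∀ (p q r : WeightedProb W) (s t : ℝ≥0), s + t = 1 →
      r.meas = s • p.meas + t • q.meas → F r ≤ s * F p + t * F q)
    (hlsc : LowerSemicontinuous F) {ν₀ : WeightedProb W} {t : ℝ} (ht0 : 0 ≤ t)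
    (ht : ENNReal.ofReal t < F ν₀) :
    ∃ φ, HasGrowth W φ ∧ ∀ ν, F ν ≠ ∞ →
      t + ∫ y, φ y ∂ν₀.meas ≤ ∫ y, φ y ∂ν.meas + (F ν).toReal := by
  obtain ⟨I, hI, ε, hε, hIS⟩ := exists_finite_nhds_weightedProb (hlsc ν₀ _ ht)
  have := hI.fintype
  let T : WeightedProb W → I → ℝ := fun ν i => ∫ y, i.1.1 y ∂ν.meas
  -- `D` is the image of the epigraph of `F` under the finitely many integrals. The box `A` misses
  -- it because `F > t` on the neighbourhood cut out by the box.
  let A : Set ((I → ℝ) × ℝ) := (Set.univ.pi fun i : I => Metric.ball (T ν₀ i) (ε i)) ×ˢ Iio t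
  let D : Set ((I → ℝ) × ℝ) := {z | ∃ ν, z.1 = T ν ∧ F ν ≠ ∞ ∧ (F ν).toReal ≤ z.2}
  have hAconv : Convex ℝ A := (convex_pi fun i _ => convex_ball _ _).prod (convex_Iio _)
  have hAopen : IsOpen A := (isOpen_set_pi finite_univ fun i _ => Metric.isOpen_ball).prod isOpen_Iio
  have hDconv : Convex ℝ D := by
    rintro ⟨_, r₁⟩ ⟨ν₁, rfl, hF₁, hr₁⟩ ⟨_, r₂⟩ ⟨ν₂, rfl, hF₂, hr₂⟩ a b ha hb hab
    lift a to ℝ≥0 using ha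
    lift b to ℝ≥0 using hb
    have hab' : a + b = 1 := by exact_mod_cast hab
    obtain ⟨ν, hν⟩ := hw.exists_convex_combination hab' ν₁ ν₂
    have hle := hconv ν₁ ν₂ ν a b hab' hν
    have hfin : (a : ℝ≥0∞) * F ν₁ + b * F ν₂ ≠ ∞ := ENNReal.add_ne_top.2
      ⟨ENNReal.mul_ne_top ENNReal.coe_ne_top hF₁, ENNReal.mul_ne_top ENNReal.coe_ne_top hF₂⟩
    refine ⟨ν, ?_, ne_top_of_le_ne_top hfin hle, ?_⟩
    · funext i
      have h1 := hw.integrable_of_hasGrowth i.1.2 ν₁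
      have h2 := hw.integrable_of_hasGrowth i.1.2 ν₂
      simp only [T, hν, Prod.smul_mk, Prod.mk_add_mk, Pi.add_apply, Pi.smul_apply]
      rw [integral_add_measure h1.smul_measure_nnreal h2.smul_measure_nnreal,
        integral_smul_nnreal_measure, integral_smul_nnreal_measure]
      rfl
    · refine (ENNReal.toReal_mono hfin hle).trans ?_
      rw [ENNReal.toReal_add (ENNReal.mul_ne_top ENNReal.coe_ne_top hF₁)
        (ENNReal.mul_ne_top ENNReal.coe_ne_top hF₂), ENNReal.toReal_mul, ENNReal.toReal_mul]
      exact add_le_add (mul_le_mul_of_nonneg_left hr₁ a.2) (mul_le_mul_of_nonneg_left hr₂ b.2)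
  have hdisj : Disjoint A D := by
    rw [Set.disjoint_left]
    rintro ⟨_, r⟩ ⟨hA1, hA2⟩ ⟨ν, rfl, hF, hr⟩
    have h1 : ENNReal.ofReal t < F ν := hIS ν fun i hi => hA1 ⟨i, hi⟩ (mem_univ _)
    rw [ENNReal.ofReal_lt_iff_lt_toReal ht0 hF] at h1
    exact (h1.trans_le hr).not_gt hA2
  obtain ⟨f, u, hfA, hfD⟩ := geometric_hahn_banach_open hAconv hAopen hDconv hdisj
  classical
  let L : (I → ℝ) →ₗ[ℝ] ℝ := f.toLinearMap ∘ₗ LinearMap.inl ℝ _ _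
  let β : ℝ := f (0, 1)
  have hf : ∀ e r, f (e, r) = L e + β * r := fun e r => by
    have : ((e, r) : (I → ℝ) × ℝ) = (e, 0) + r • (0, 1) := by simp
    rw [this, map_add, map_smul, smul_eq_mul, mul_comm]
    rfl
  let φ : Y → ℝ := fun y => ∑ i : I, L (Pi.single i 1) * i.1.1 y
  have hφ : HasGrowth W φ := hw.hasGrowth_sum _ _ fun i : I => i.1.2
  have hφint : ∀ ν, ∫ y, φ y ∂ν.meas = L (T ν) := fun ν => by
    rw [integral_finsetSum _ fun i _ => (hw.integrable_of_hasGrowth i.1.2 ν).const_mul _,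
      LinearMap.pi_apply_eq_sum_univ L (T ν)]
    refine Finset.sum_congr rfl fun i _ => ?_
    rw [integral_const_mul, smul_eq_mul, mul_comm]
    congr 2
    funext j
    simp [Pi.single_apply, eq_comm]
  have hcenter : ∀ r < t, L (T ν₀) + β * r < u := fun r hr => by
    rw [← hf]
    exact hfA _ ⟨fun i _ => Metric.mem_ball_self (hε i), hr⟩
  -- `A` is unbounded in the direction of negative `r`, so a negative slope would violate the bound
  -- by `u`.
  have hβ : 0 ≤ β := by
    by_contra! hβ
    have h1 := hcenter (min (t - 1) ((u - L (T ν₀)) / β))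
      ((min_le_left _ _).trans_lt (by linarith))
    have h2 : u - L (T ν₀) ≤ β * min (t - 1) ((u - L (T ν₀)) / β) := by
      have := mul_le_mul_of_nonpos_left (min_le_right (t - 1) ((u - L (T ν₀)) / β)) hβ.le
      rwa [mul_div_cancel₀ _ hβ.ne] at this
    linarith
  have hcenter' : L (T ν₀) + β * t ≤ u := by
    refine le_of_forall_pos_le_add fun δ hδ => ?_
    have h1 := hcenter (t - δ / (β + 1)) (by linarith [div_pos hδ (by linarith : 0 < β + 1)])
    have h2 : β * (δ / (β + 1)) ≤ δ := by
      rw [mul_div_assoc', div_le_iff₀ (by linarith)]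
      nlinarith
    linarith
  have hD : ∀ ν, F ν ≠ ∞ → u ≤ L (T ν) + β * (F ν).toReal := fun ν hν => by
    rw [← hf]
    exact hfD _ ⟨ν, rfl, hν, le_rfl⟩
  have hscale : ∀ k : ℝ, HasGrowth W fun y => k * φ y := fun k => by
    simpa using hw.hasGrowth_sum (Finset.univ : Finset Unit) (fun _ => k) fun _ => hφ
  -- For `β = 0` the hyperplane is vertical: it separates `ν₀` strictly from the domain of `F`, and
  -- scaling widens this gap to `t`, which suffices as `F ≥ 0`. For `β > 0` one divides by `β`.
  rcases hβ.eq_or_lt with hβ0 | hβ0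
  · have hδ : 0 < u - L (T ν₀) := by
      have := hcenter (t - 1) (by linarith)
      rw [← hβ0] at this
      linarith
    refine ⟨_, hscale (t / (u - L (T ν₀))), fun ν hν => ?_⟩
    simp only [integral_const_mul, hφint]
    have h1 := hD ν hν
    rw [← hβ0, zero_mul, add_zero] at h1
    have h2 := mul_le_mul_of_nonneg_left (sub_le_sub_right h1 (L (T ν₀))) (div_nonneg ht0 hδ.le)
    rw [div_mul_cancel₀ _ hδ.ne'] at h2
    linarith [ENNReal.toReal_nonneg (a := F ν)]
  · refine ⟨_, hscale β⁻¹, fun ν hν => ?_⟩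
    simp only [integral_const_mul, hφint]
    have h1 := mul_le_mul_of_nonneg_left (hcenter'.trans (hD ν hν)) (inv_nonneg.2 hβ)
    rw [mul_add, mul_add, inv_mul_cancel_left₀ hβ0.ne', inv_mul_cancel_left₀ hβ0.ne'] at h1
    linarith

end Duality

/-! ### Measurable minimizers over a compact set of reals -/

section Minimizer

variable {X : Type*} [TopologicalSpace X]

lemma lowerSemicontinuous_biInf_of_isCompact {K : Type*} [TopologicalSpace K] {C : Set K}
    (hC : IsCompact C) {g : X → K → ℝ≥0∞} (hg : LowerSemicontinuous (Function.uncurry g)) :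
    LowerSemicontinuous fun x => ⨅ k ∈ C, g x k := by
  intro x₀ t ht
  obtain ⟨t', htt', ht'⟩ := exists_between ht
  have h : ∀ᶠ x in 𝓝 x₀, ∀ k ∈ C, t' < g x k :=
    hC.eventually_forall_of_forall_eventually fun k hk =>
      hg (x₀, k) t' (ht'.trans_le (iInf₂_le k hk))
  filter_upwards [h] with x hx
  exact htt'.trans_le (le_iInf₂ fun k hk => (hx k hk).le)

/-- A jointly lower semicontinuous function `g` on `X × K`, with `K` a compact set of real
numbers, has a measurable selection of minimizers of `g x`. -/
lemma exists_measurable_isMin [MeasurableSpace X] [OpensMeasurableSpace X] {K : Set ℝ}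
    (hK : IsCompact K) (hne : K.Nonempty) {g : X → K → ℝ≥0∞}
    (hg : LowerSemicontinuous (Function.uncurry g)) :
    (Measurable fun x => ⨅ k, g x k) ∧ ∃ s : X → K, Measurable s ∧ ∀ x k, g x (s x) ≤ g x k := by
  have : CompactSpace K := isCompact_iff_compactSpace.1 hK
  have : Nonempty K := hne.to_subtype
  have hgx : ∀ x, LowerSemicontinuous (g x) := fun x =>
    LowerSemicontinuous.comp (g := fun k => (x, k)) hg (by fun_prop)
  have hmin : ∀ x, ∀ C : Set K, IsCompact C → C.Nonempty → ∃ k ∈ C, ∀ k' ∈ C, g x k ≤ g x k' :=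
    fun x C hC hCne => LowerSemicontinuousOn.exists_isMinOn hCne hC ((hgx x).lowerSemicontinuousOn _)
  have hm : Measurable fun x => ⨅ k, g x k := by
    have := (lowerSemicontinuous_biInf_of_isCompact (isCompact_univ (X := K)) hg).measurable
    simpa using this
  refine ⟨hm, ?_⟩
  -- The selection is the least minimizer in the order of `ℝ`.
  have hex : ∀ x, ∃ k : K, g x k ≤ ⨅ k, g x k ∧ ∀ k' : K, g x k' ≤ (⨅ k, g x k) → (k : ℝ) ≤ k' := by
    intro x
    obtain ⟨k₀, -, hk₀⟩ := hmin x univ isCompact_univ univ_nonempty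
    have hcl : IsClosed {k : K | g x k ≤ ⨅ k, g x k} := (hgx x).isClosed_preimage _
    obtain ⟨k, hk, hkmin⟩ := hcl.isCompact.exists_isMinOn
      ⟨k₀, le_iInf fun k => hk₀ k (mem_univ k)⟩ (continuous_subtype_val (p := (· ∈ K))).continuousOn
    exact ⟨k, hk, fun k' hk' => hkmin hk'⟩
  choose s hs hsmin using hex
  refine ⟨s, ?_, fun x k => (hs x).trans (iInf_le _ k)⟩
  suffices Measurable fun x => (s x : ℝ) from this.subtype_mk
  refine measurable_of_Iic fun a => ?_
  let C : Set K := {k | (k : ℝ) ≤ a}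
  have hC : IsCompact C := (isClosed_le continuous_subtype_val continuous_const).isCompact
  rcases C.eq_empty_or_nonempty with hCe | hCne
  · have : (fun x => (s x : ℝ)) ⁻¹' Iic a = ∅ := by
      ext x
      have : s x ∉ C := hCe ▸ notMem_empty _
      simpa [C] using this
    rw [this]
    exact MeasurableSet.empty
  -- The least minimizer is at most `a` exactly when the minimum over `C` does not exceed the global
  -- minimum.
  · have : (fun x => (s x : ℝ)) ⁻¹' Iic a = {x | ⨅ k ∈ C, g x k ≤ ⨅ k, g x k} := by
      ext x
      constructor
      · exact fun hx => (iInf₂_le (f := fun k (_ : k ∈ C) => g x k) (s x) hx).trans (hs x)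
      · intro hx
        obtain ⟨k, hk, hkmin⟩ := hmin x C hC hCne
        exact (hsmin x k ((le_iInf₂ hkmin).trans hx)).trans hk
    rw [this]
    exact measurableSet_le (lowerSemicontinuous_biInf_of_isCompact hC hg).measurable hm

end Minimizer

/-! ### Measurable near-minimizers in the three settings -/

section Selection

variable {X : Type*} [MetricSpace X] [MeasurableSpace X] {γ : ℝ≥0 → ℝ≥0}

/-- The infimum over `p` of `∫ f dp + c (x, p)`, for a nonnegative function `f`. -/
noncomputable def minCost (c : X → PGamma γ X → ℝ≥0∞) (f : X → ℝ) (x : X) : ℝ≥0∞ :=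
  ⨅ p : PGamma γ X, (∫⁻ y, ENNReal.ofReal (f y) ∂p.meas + c x p)

/-- `minCost` is measurable and has measurable approximate minimizers. -/
def HasSelection (c : X → PGamma γ X → ℝ≥0∞) (f : X → ℝ) : Prop :=
  Measurable (minCost c f) ∧ ∀ ε : ℝ≥0∞, ε ≠ 0 → ∃ p : X → PGamma γ X, Measurable p ∧
    ∀ x, ∫⁻ y, ENNReal.ofReal (f y) ∂(p x).meas + c x (p x) ≤ minCost c f x + ε

variable [BorelSpace X] {w : X → ℝ} {c : X → PGamma γ X → ℝ≥0∞} {f : X → ℝ}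

lemma IsControl.continuous_lintegral (hw : IsControl (weight γ X) w)
    (hf : HasGrowth (weight γ X) f) (hf0 : ∀ x, 0 ≤ f x) :
    Continuous fun p : PGamma γ X => ∫⁻ y, ENNReal.ofReal (f y) ∂p.meas := by
  have : ∀ p : PGamma γ X, ∫⁻ y, ENNReal.ofReal (f y) ∂p.meas =
      ENNReal.ofReal (∫ y, f y ∂p.meas) := fun p =>
    (ofReal_integral_eq_lintegral_ofReal (hw.integrable_of_hasGrowth hf p) (.of_forall hf0)).symm
  simp only [this]
  exact ENNReal.continuous_ofReal.comp hf.continuous_integral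

variable [Nonempty X]

lemma exists_le_minCost_add (c : X → PGamma γ X → ℝ≥0∞) (f : X → ℝ) {ε : ℝ≥0∞} (hε : ε ≠ 0)
    (x : X) : ∃ p : PGamma γ X, ∫⁻ y, ENNReal.ofReal (f y) ∂p.meas + c x p ≤ minCost c f x + ε := by
  rcases eq_or_ne (minCost c f x) ∞ with h | h
  · exact ⟨Classical.arbitrary _, by simp [h]⟩
  · obtain ⟨p, hp⟩ := iInf_lt_iff.1 (ENNReal.lt_add_right h hε)
    exact ⟨p, hp.le⟩

lemma hasSelection_of_countable [Countable X] : HasSelection c f :=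
  ⟨measurable_of_countable _, fun ε hε => by
    choose p hp using exists_le_minCost_add c f hε
    exact ⟨p, measurable_of_countable _, hp⟩⟩

/-- By continuity in `p` the infimum may be taken over a dense sequence, and the first index within
`ε` of it is measurable in `x`. -/
lemma IsControl.hasSelection_of_continuous [SecondCountableTopology X]
    (hw : IsControl (weight γ X) w) (hc : Measurable (Function.uncurry c)) (hc3 : CondC3 c)
    (hf : HasGrowth (weight γ X) f) (hf0 : ∀ x, 0 ≤ f x) : HasSelection c f := by
  classical
  have := hw.secondCountableTopology
  let D : ℕ → PGamma γ X := TopologicalSpace.denseSeq _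
  let g : X → PGamma γ X → ℝ≥0∞ := fun x p => ∫⁻ y, ENNReal.ofReal (f y) ∂p.meas + c x p
  have hgc : ∀ x, Continuous (g x) := fun x => (hw.continuous_lintegral hf hf0).add
    ((show Continuous (Function.uncurry c) from hc3).comp (by fun_prop : Continuous fun p => (x, p)))
  have hgm : ∀ p, Measurable fun x => g x p := fun p =>
    (hc.comp (measurable_id.prodMk measurable_const)).const_add _
  have hlt : ∀ x a, minCost c f x < a → ∃ n, g x (D n) < a := fun x a ha => by
    obtain ⟨p, hp⟩ := iInf_lt_iff.1 ha
    exact (TopologicalSpace.denseRange_denseSeq _).exists_mem_open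
      (isOpen_lt (hgc x) continuous_const) ⟨p, hp⟩
  have hmin : minCost c f = fun x => ⨅ n, g x (D n) := by
    funext x
    refine le_antisymm (le_iInf fun n => iInf_le _ _) (le_of_forall_gt fun a ha => ?_)
    obtain ⟨n, hn⟩ := hlt x a ha
    exact (iInf_le _ n).trans_lt hn
  have hm : Measurable (minCost c f) := by
    rw [hmin]
    exact Measurable.iInf fun n => hgm _
  refine ⟨hm, fun ε hε => ?_⟩
  have hex : ∀ x, ∃ n, g x (D n) ≤ minCost c f x + ε := fun x => by
    rcases eq_or_ne (minCost c f x) ∞ with h | h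
    · exact ⟨0, by simp [h]⟩
    · obtain ⟨n, hn⟩ := hlt x _ (ENNReal.lt_add_right h hε)
      exact ⟨n, hn.le⟩
  refine ⟨fun x => D (Nat.find (hex x)), ?_, fun x => Nat.find_spec (hex x)⟩
  exact (measurable_from_nat (f := D)).comp
    (measurable_find hex fun n => measurableSet_le (hgm _) (hm.add_const _))

lemma measurable_of_continuous_weightedProb {Z : Type*} [TopologicalSpace Z] [MeasurableSpace Z]
    [OpensMeasurableSpace Z] {p : Z → PGamma γ X} (hp : Continuous p) : Measurable p := by
  rw [measurable_iff_meas]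
  refine Measurable.measure_of_isPiSystem_of_isProbabilityMeasure
    (BorelSpace.measurable_eq.trans borel_eq_generateFrom_isClosed) isPiSystem_isClosed
    fun F hF => ?_
  have hF' : IsClosed F := hF
  refine measurable_of_tendsto_metrizable (f := fun n z =>
    ∫⁻ y, (hF'.apprSeq n y : ℝ≥0∞) ∂(p z).meas) (fun n => ?_) ?_
  · have h1 := ProbabilityMeasure.continuous_lintegral_boundedContinuousFunction (hF'.apprSeq n)
    exact (h1.comp (continuous_toProb.comp hp)).measurable
  · rw [tendsto_pi_nhds]
    exact fun z => HasOuterApproxClosed.tendsto_lintegral_apprSeq hF' (p z).meas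

/-- On a compact space every probability measure lies in `P_γ(X)` and weak convergence suffices, so
a compact metrizable space maps continuously onto `P_γ(X)`. The Cantor set supplies the linear order
used to select minimizers. -/
lemma IsControl.exists_continuous_surjective_of_compactSpace [CompactSpace X]
    (hw : IsControl (weight γ X) w) :
    ∃ q : cantorSet → PGamma γ X, Continuous q ∧ Function.Surjective q := by
  have hmom : ∀ m : ProbabilityMeasure X, HasMoment (weight γ X) (m : Measure X) := fun m => by
    rw [hw.hasMoment_iff]
    have hint : Integrable w (m : Measure X) :=
      (BoundedContinuousFunction.mkOfCompact ⟨w, hw.cont⟩).integrable _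
    rw [← hasFiniteIntegral_iff_ofReal (.of_forall hw.nonneg)]
    exact hint.2
  let e : ProbabilityMeasure X → PGamma γ X := fun m => ⟨m, hmom m⟩
  have he : Continuous e := by
    rw [continuous_weightedProb_iff]
    intro φ hφ
    exact ProbabilityMeasure.continuous_integral_boundedContinuousFunction
      (BoundedContinuousFunction.mkOfCompact ⟨φ, hφ.1⟩)
  have hne : Nonempty (ProbabilityMeasure X) := ⟨(Classical.arbitrary (PGamma γ X)).toProb⟩
  let : MetricSpace (ProbabilityMeasure X) := TopologicalSpace.metrizableSpaceMetric _
  obtain ⟨q, hqc, hqs⟩ := exists_nat_bool_continuous_surjective_of_compact (ProbabilityMeasure X)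
  refine ⟨fun k => e (q (cantorSetHomeomorphNatToBool k)), he.comp (hqc.comp (Homeomorph.continuous _)),
    fun p => ?_⟩
  obtain ⟨b, hb⟩ := hqs p.toProb
  exact ⟨cantorSetHomeomorphNatToBool.symm b, by simp [e, hb]⟩

lemma IsControl.hasSelection_of_compactSpace (hw : IsControl (weight γ X) w) (hc3 : CondC3' c)
    (hf : HasGrowth (weight γ X) f) (hf0 : ∀ x, 0 ≤ f x) : HasSelection c f := by
  obtain ⟨hX, hlsc⟩ := hc3
  obtain ⟨q, hqc, hqs⟩ := hw.exists_continuous_surjective_of_compactSpace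
  let g : X → cantorSet → ℝ≥0∞ := fun x k =>
    ∫⁻ y, ENNReal.ofReal (f y) ∂(q k).meas + c x (q k)
  have hg : LowerSemicontinuous (Function.uncurry g) := by
    refine LowerSemicontinuous.add (f := fun z : X × cantorSet =>
      ∫⁻ y, ENNReal.ofReal (f y) ∂(q z.2).meas) (g := fun z => c z.1 (q z.2)) ?_ ?_
    · exact ((hw.continuous_lintegral hf hf0).comp (hqc.comp continuous_snd)).lowerSemicontinuous
    · exact LowerSemicontinuous.comp (g := fun z : X × cantorSet => (z.1, q z.2)) hlsc (by fun_prop)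
  obtain ⟨hm, s, hs, hsmin⟩ := exists_measurable_isMin isCompact_cantorSet ⟨0, zero_mem_cantorSet⟩ hg
  have hmin : minCost c f = fun x => ⨅ k, g x k := by
    funext x
    exact (hqs.iInf_comp (fun p => ∫⁻ y, ENNReal.ofReal (f y) ∂p.meas + c x p)).symm
  refine ⟨hmin ▸ hm, fun ε _ => ⟨fun x => q (s x),
    (measurable_of_continuous_weightedProb hqc).comp hs, fun x => ?_⟩⟩
  rw [hmin]
  exact (le_iInf (hsmin x)).trans le_self_add

end Selection

/-! ### Extended integrals and shifts by a constant -/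

section ExtendedIntegral

lemma continuous_coe_sub_const (m : ℝ≥0) :
    Continuous fun a : ℝ≥0∞ => (a : EReal) - ((m : ℝ) : EReal) := by
  rw [continuous_iff_continuousAt]
  intro a
  simp only [sub_eq_add_neg]
  have h := EReal.continuousAt_add (p := ((a : EReal), -((m : ℝ) : EReal)))
    (Or.inr (by simp [← EReal.coe_neg])) (Or.inr (by simp [← EReal.coe_neg]))
  exact h.comp (f := fun a : ℝ≥0∞ => ((a : EReal), -((m : ℝ) : EReal)))
    (continuous_coe_ennreal_ereal.prodMk continuous_const).continuousAt

/-- With truncated subtraction, `(g - m) + m = g + (m - g)`. This integrates to the claim, as `∫ (m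
- g) ≤ m` is finite. -/
lemma extIntegral_sub_const {X : Type*} [MeasurableSpace X] (μ : Measure X)
    [IsProbabilityMeasure μ] {g : X → ℝ≥0∞} (hg : Measurable g) (m : ℝ≥0) :
    extIntegral μ (fun x => (g x : EReal) - ((m : ℝ) : EReal)) =
      ((∫⁻ x, g x ∂μ : ℝ≥0∞) : EReal) - ((m : ℝ) : EReal) := by
  have hm : ((m : ℝ) : EReal) = ((m : ℝ≥0∞) : EReal) := rfl
  have hpos : ∀ x, ((g x : EReal) - ((m : ℝ) : EReal)).toENNReal = g x - m := fun x => by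
    rw [hm, EReal.toENNReal_sub (EReal.coe_ennreal_nonneg _)]
    simp
  have hneg : ∀ x, (-((g x : EReal) - ((m : ℝ) : EReal))).toENNReal = m - g x := fun x => by
    rw [EReal.neg_sub (Or.inr (by simp)) (Or.inr (by simp)), hm, add_comm, ← sub_eq_add_neg,
      EReal.toENNReal_sub (EReal.coe_ennreal_nonneg _)]
    simp
  simp only [extIntegral, hpos, hneg]
  have hsum : ∫⁻ x, (g x - m) ∂μ + m = ∫⁻ x, g x ∂μ + ∫⁻ x, (m - g x) ∂μ := by
    rw [← lintegral_add_left hg]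
    calc ∫⁻ x, (g x - m) ∂μ + m = ∫⁻ x, (g x - m) ∂μ + ∫⁻ _, (m : ℝ≥0∞) ∂μ := by simp
      _ = ∫⁻ x, (g x - m + m) ∂μ := (lintegral_add_right _ measurable_const).symm
      _ = ∫⁻ x, (g x + (m - g x)) ∂μ := lintegral_congr fun x => by
          rw [tsub_add_eq_max, add_tsub_eq_max]
  have hN : ∫⁻ x, (m - g x) ∂μ ≤ m := (lintegral_mono fun x => tsub_le_self).trans_eq (by simp)
  generalize ∫⁻ x, (g x - m) ∂μ = P at *
  generalize ∫⁻ x, (m - g x) ∂μ = N at *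
  generalize ∫⁻ x, g x ∂μ = G at *
  lift N to ℝ≥0 using ne_top_of_le_ne_top ENNReal.coe_ne_top hN
  rcases eq_or_ne G ∞ with rfl | hG
  · have : P = ∞ := by simpa using hsum
    simp [this]
  · lift G to ℝ≥0 using hG
    have hP : P ≠ ∞ := by
      rintro rfl
      simp [← ENNReal.coe_add] at hsum
    lift P to ℝ≥0 using hP
    have h : (P : ℝ) + m = G + N := by exact_mod_cast hsum
    change ((P : ℝ) : EReal) - ((N : ℝ) : EReal) = ((G : ℝ) : EReal) - ((m : ℝ) : EReal)
    rw [← EReal.coe_sub, ← EReal.coe_sub, EReal.coe_eq_coe_iff]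
    linarith

end ExtendedIntegral

/-! ### Truncation from below -/

section Truncation

variable {B Y : Type*} [Nonempty B] [TopologicalSpace Y] {W : B → Y → ℝ≥0} {w : Y → ℝ} {φ : Y → ℝ}

lemma abs_max_neg_le {a k : ℝ} (hk : 0 ≤ k) : |max a (-k)| ≤ |a| := by
  rcases le_total a (-k) with h | h
  · rw [max_eq_right h, abs_of_nonpos (by linarith), abs_of_nonpos (by linarith)]
    linarith
  · rw [max_eq_left h]

lemma IsControl.hasGrowth_max (hw : IsControl W w) (hφ : HasGrowth W φ) (k : ℕ) :
    HasGrowth W fun y => max (φ y) (-k) := by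
  obtain ⟨hc, b, hb, h⟩ := hw.hasGrowth_iff.1 hφ
  exact hw.hasGrowth_iff.2 ⟨hc.max continuous_const, b, hb, fun y =>
    (abs_max_neg_le k.cast_nonneg).trans (h y)⟩

lemma IsControl.hasGrowth_add_const (hw : IsControl W w) (hφ : HasGrowth W φ) (m : ℝ≥0) :
    HasGrowth W fun y => φ y + m := by
  obtain ⟨hc, b, hb, h⟩ := hw.hasGrowth_iff.1 hφ
  refine hw.hasGrowth_iff.2 ⟨hc.add continuous_const, b + m, by positivity, fun y => ?_⟩
  have := hw.one_le y
  calc |φ y + m| ≤ |φ y| + m := (abs_add_le _ _).trans_eq (by rw [NNReal.abs_eq])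
    _ ≤ (b + m) * w y := by nlinarith [h y, m.coe_nonneg]

variable [MeasurableSpace Y] [BorelSpace Y]

lemma IsControl.exists_integral_max_lt (hw : IsControl W w) (hφ : HasGrowth W φ)
    (ν : WeightedProb W) {s : ℝ} (hs : ∫ y, φ y ∂ν.meas < s) :
    ∃ k : ℕ, ∫ y, max (φ y) (-k) ∂ν.meas < s := by
  have h : Tendsto (fun k : ℕ => ∫ y, max (φ y) (-k) ∂ν.meas) atTop (𝓝 (∫ y, φ y ∂ν.meas)) := by
    refine tendsto_integral_of_dominated_convergence (fun y => |φ y|)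
      (fun k => (hw.hasGrowth_max hφ k).1.measurable.aestronglyMeasurable)
      (hw.integrable_of_hasGrowth hφ ν).abs
      (fun k => .of_forall fun y => abs_max_neg_le k.cast_nonneg) (.of_forall fun y => ?_)
    refine tendsto_const_nhds.congr' ?_
    filter_upwards [eventually_ge_atTop ⌈-φ y⌉₊] with k hk
    exact (max_eq_left (by linarith [Nat.ceil_le.1 hk])).symm
  exact (h.eventually_lt_const hs).exists

end Truncation

/-! ### The duality inequalities -/

section Duality

lemma exists_bind_eq_meas {X : Type*} [MetricSpace X] [MeasurableSpace X] {γ : ℝ≥0 → ℝ≥0}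
    {c : X → PGamma γ X → ℝ≥0∞} (hc4 : CondC4 c) (μ : PGamma γ X) {p : X → PGamma γ X}
    (hp : Measurable p) (hfin : ∫⁻ x, c x (p x) ∂μ.meas < ∞) :
    ∃ ν : PGamma γ X, μ.meas.bind (fun x => (p x).meas) = ν.meas := by
  have : IsProbabilityMeasure (μ.meas.bind fun x => (p x).meas) :=
    inferInstanceAs (IsProbabilityMeasure (μ.meas.bind (toKernel p hp)))
  exact ⟨⟨⟨_, this⟩, hc4 μ p hp hfin⟩, rfl⟩

variable {X : Type*} [MetricSpace X] [MeasurableSpace X] [BorelSpace X]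
  {γ : ℝ≥0 → ℝ≥0} {w : X → ℝ} {c : X → PGamma γ X → ℝ≥0∞} {φ : X → ℝ}

lemma IsControl.integral_add_const_nonneg (hw : IsControl (weight γ X) w)
    (hφ : HasGrowth (weight γ X) φ) {m : ℝ≥0} (hm : ∀ x, 0 ≤ φ x + m) (p : PGamma γ X) :
    0 ≤ ∫ x, φ x ∂p.meas + m := by
  have h := integral_nonneg (μ := p.meas) (f := fun x => φ x + m) hm
  rwa [integral_add (hw.integrable_of_hasGrowth hφ p) (integrable_const _), integral_const,
    probReal_univ, one_smul] at h

variable [Nonempty X]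

lemma IsControl.lintegral_add_const (hw : IsControl (weight γ X) w)
    (hφ : HasGrowth (weight γ X) φ) {m : ℝ≥0} (hm : ∀ x, 0 ≤ φ x + m) (p : PGamma γ X) :
    ∫⁻ x, ENNReal.ofReal (φ x + m) ∂p.meas = ENNReal.ofReal (∫ x, φ x ∂p.meas + m) := by
  rw [← ofReal_integral_eq_lintegral_ofReal
    (hw.integrable_of_hasGrowth (hw.hasGrowth_add_const hφ m) p) (.of_forall hm),
    integral_add (hw.integrable_of_hasGrowth hφ p) (integrable_const _)]
  simp

/-- Shifting `φ` by `m` moves the problem into `[0, ∞]`; subtracting a finite constant is continuous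
and monotone, so it commutes with the infimum. -/
lemma IsControl.Rc_eq (hw : IsControl (weight γ X) w) (hφ : HasGrowth (weight γ X) φ) {m : ℝ≥0}
    (hm : ∀ x, 0 ≤ φ x + m) : Rc c φ = fun x =>
      (minCost c (fun x => φ x + m) x : EReal) - ((m : ℝ) : EReal) := by
  funext x
  have hmono : Monotone fun a : ℝ≥0∞ => (a : EReal) - ((m : ℝ) : EReal) := fun a b hab =>
    EReal.sub_le_sub (EReal.coe_ennreal_le_coe_ennreal_iff.2 hab) le_rfl
  refine Eq.trans (iInf_congr fun p => ?_) (Monotone.map_iInf_of_continuousAt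
    (continuous_coe_sub_const m).continuousAt hmono
    (by rw [EReal.coe_ennreal_top, EReal.top_sub_coe])).symm
  simp only [Function.comp_apply]
  rw [hw.lintegral_add_const hφ hm, EReal.coe_ennreal_add, EReal.coe_ennreal_ofReal,
    max_eq_left (hw.integral_add_const_nonneg hφ hm p), EReal.coe_add, sub_eq_add_neg]
  have : ((m : ℝ) : EReal) + -((m : ℝ) : EReal) = 0 := by
    rw [← EReal.coe_neg, ← EReal.coe_add, add_neg_cancel, EReal.coe_zero]
  rw [add_right_comm, add_assoc _ ((m : ℝ) : EReal), this, add_zero]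

lemma IsControl.dual_value_eq (hw : IsControl (weight γ X) w) (hφ : HasGrowth (weight γ X) φ)
    {m : ℝ≥0} (hm : ∀ x, 0 ≤ φ x + m) (hmeas : Measurable (minCost c fun x => φ x + m))
    (μ ν : PGamma γ X) :
    extIntegral μ.meas (Rc c φ) - ((∫ y, φ y ∂ν.meas : ℝ) : EReal) =
      ((∫⁻ x, minCost c (fun x => φ x + m) x ∂μ.meas : ℝ≥0∞) : EReal) -
        ((∫⁻ x, ENNReal.ofReal (φ x + m) ∂ν.meas : ℝ≥0∞) : EReal) := by
  rw [hw.Rc_eq hφ hm, extIntegral_sub_const _ hmeas, hw.lintegral_add_const hφ hm,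
    EReal.coe_ennreal_ofReal, max_eq_left (hw.integral_add_const_nonneg hφ hm ν)]
  generalize ∫⁻ x, minCost c (fun x => φ x + m) x ∂μ.meas = A
  rcases eq_or_ne A ∞ with rfl | hA
  · rw [EReal.coe_ennreal_top, EReal.top_sub_coe, EReal.top_sub_coe, EReal.top_sub_coe]
  · lift A to ℝ≥0 using hA
    change ((A : ℝ) : EReal) - _ - _ = ((A : ℝ) : EReal) - _
    rw [← EReal.coe_sub, ← EReal.coe_sub, ← EReal.coe_sub, EReal.coe_eq_coe_iff]
    ring

variable [CompleteSpace X] [SecondCountableTopology X]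

/-- The easy inequality of the duality theorem. -/
lemma IsControl.lintegral_minCost_le (hw : IsControl (weight γ X) w)
    (hc : Measurable (Function.uncurry c)) {f : X → ℝ}
    (hf : Measurable f) (μ ν : PGamma γ X) :
    ∫⁻ x, minCost c f x ∂μ.meas ≤ Tc c ν μ + ∫⁻ x, ENNReal.ofReal (f x) ∂ν.meas := by
  refine le_of_forall_gt fun a ha => ?_
  have hF : ∫⁻ x, ENNReal.ofReal (f x) ∂ν.meas ≠ ∞ := fun h => by simp [h] at ha
  obtain ⟨b, hb, hab⟩ : ∃ b, Tc c ν μ < b ∧ b + ∫⁻ x, ENNReal.ofReal (f x) ∂ν.meas ≤ a :=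
    ⟨a - ∫⁻ x, ENNReal.ofReal (f x) ∂ν.meas, lt_tsub_iff_right.2 ha,
      (tsub_add_cancel_of_le (le_add_self.trans ha.le)).le⟩
  obtain ⟨p, hp, hpν, hpb⟩ := hw.exists_kernel_of_Tc_lt hb
  have hpm := measurable_iff_meas.1 hp
  have hfm : Measurable fun x => ENNReal.ofReal (f x) := hf.ennreal_ofReal
  refine lt_of_lt_of_le ?_ hab
  calc ∫⁻ x, minCost c f x ∂μ.meas
      ≤ ∫⁻ x, (∫⁻ y, ENNReal.ofReal (f y) ∂(p x).meas + c x (p x)) ∂μ.meas :=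
        lintegral_mono fun x => iInf_le _ (p x)
    _ = ∫⁻ x, c x (p x) ∂μ.meas + ∫⁻ x, ENNReal.ofReal (f x) ∂ν.meas := by
        rw [lintegral_add_right _ (measurable_cost hc hp), ← hpν,
          Measure.lintegral_bind hpm.aemeasurable hfm.aemeasurable, add_comm]
    _ < b + ∫⁻ x, ENNReal.ofReal (f x) ∂ν.meas := ENNReal.add_lt_add_right hF hpb

/-- Exchange of infimum and integral: `ν = μ p` for a measurable near-minimizer `p`, whose total
cost is finite, so that (C₄) applies. -/
lemma exists_lintegral_add_Tc_le (hc : Measurable (Function.uncurry c)) (hc4 : CondC4 c)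
    (μ : PGamma γ X) {f : X → ℝ} (hf : Measurable f) (hsel : HasSelection c f) {a : ℝ≥0∞}
    (ha : ∫⁻ x, minCost c f x ∂μ.meas < a) :
    ∃ ν : PGamma γ X, ∫⁻ x, ENNReal.ofReal (f x) ∂ν.meas + Tc c ν μ < a := by
  obtain ⟨ε, hε, hεa⟩ := ENNReal.lt_iff_exists_add_pos_lt.1 ha
  obtain ⟨p, hp, hpε⟩ := hsel.2 ε (by exact_mod_cast hε.ne')
  have hpm := measurable_iff_meas.1 hp
  have hfm : Measurable fun x => ENNReal.ofReal (f x) := hf.ennreal_ofReal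
  have hle : ∫⁻ x, ∫⁻ y, ENNReal.ofReal (f y) ∂(p x).meas ∂μ.meas + ∫⁻ x, c x (p x) ∂μ.meas < a := by
    rw [← lintegral_add_right _ (measurable_cost hc hp)]
    refine ((lintegral_mono hpε).trans_eq ?_).trans_lt hεa
    rw [lintegral_add_right _ measurable_const]
    simp
  obtain ⟨ν, hν⟩ := exists_bind_eq_meas hc4 μ hp ((le_add_self.trans_lt hle).trans_le le_top)
  refine ⟨ν, lt_of_le_of_lt (add_le_add ?_ (Tc_le_of_kernel hp hν)) hle⟩
  rw [← hν, Measure.lintegral_bind hpm.aemeasurable hfm.aemeasurable]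

/-- An affine minorant of the transport cost at a level `t > s` is truncated from below, and the
room `t - s` pays for the truncation at `ν`. -/
lemma IsControl.exists_phiB_lt (hw : IsControl (weight γ X) w)
    (hc : Measurable (Function.uncurry c)) (hc1 : CondC1 c) (hc2 : CondC2 c) (hc4 : CondC4 c)
    (hsel : ∀ f, HasGrowth (weight γ X) f → (∀ x, 0 ≤ f x) → HasSelection c f)
    {μ ν : PGamma γ X} {s : ℝ} (hs0 : 0 ≤ s) (hs : ENNReal.ofReal s < Tc c ν μ) :
    ∃ φ, HasGrowth (weight γ X) φ ∧ ∃ m : ℝ≥0, (∀ x, 0 ≤ φ x + m) ∧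
      ENNReal.ofReal s + ∫⁻ x, ENNReal.ofReal (φ x + m) ∂ν.meas ≤
        ∫⁻ x, minCost c (fun x => φ x + m) x ∂μ.meas := by
  obtain ⟨t, ht0, hst, ht⟩ : ∃ t : ℝ, 0 ≤ t ∧ s < t ∧ ENNReal.ofReal t < Tc c ν μ := by
    obtain ⟨b, hb1, hb2⟩ := exists_between hs
    have hb : b ≠ ∞ := hb2.ne_top
    exact ⟨b.toReal, ENNReal.toReal_nonneg, (ENNReal.ofReal_lt_iff_lt_toReal hs0 hb).1 hb1,
      by rwa [ENNReal.ofReal_toReal hb]⟩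
  obtain ⟨φ, hφ, haff⟩ := hw.exists_affine_minorant
    (fun _ _ _ _ _ hst h => hw.Tc_convex hc hc2 μ hst h) (hw.lowerSemicontinuous_Tc hc1 μ) ht0 ht
  obtain ⟨k, hk⟩ := hw.exists_integral_max_lt hφ ν
    (show ∫ y, φ y ∂ν.meas < ∫ y, φ y ∂ν.meas + (t - s) by linarith)
  have hψ := hw.hasGrowth_max hφ k
  have hψ0 : ∀ x, 0 ≤ max (φ x) (-(k : ℝ)) + (k : ℝ≥0) := fun x => by
    have := le_max_right (φ x) (-(k : ℝ))
    simp only [NNReal.coe_natCast]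
    linarith
  refine ⟨_, hψ, k, hψ0, ?_⟩
  -- Too small a dual value would produce a `ν'` violating the minorant inequality, since truncation
  -- only increases `∫ φ dν'`.
  by_contra! hlt
  have hgr := hw.hasGrowth_add_const hψ k
  obtain ⟨ν', hν'⟩ := exists_lintegral_add_Tc_le hc hc4 μ hgr.1.measurable (hsel _ hgr hψ0) hlt
  have hfin : Tc c ν' μ ≠ ∞ := ((le_add_self.trans_lt hν').trans_le le_top).ne
  have h1 := haff ν' hfin
  have h2 : ∫ y, φ y ∂ν'.meas ≤ ∫ y, max (φ y) (-k) ∂ν'.meas :=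
    integral_mono (hw.integrable_of_hasGrowth hφ _) (hw.integrable_of_hasGrowth hψ _)
      fun y => le_max_left _ _
  rw [hw.lintegral_add_const hψ hψ0, hw.lintegral_add_const hψ hψ0] at hν'
  have h3 := hw.integral_add_const_nonneg hψ hψ0 ν
  have h4 := hw.integral_add_const_nonneg hψ hψ0 ν'
  rw [← ENNReal.ofReal_add hs0 h3, ← ENNReal.ofReal_toReal hfin,
    ← ENNReal.ofReal_add h4 ENNReal.toReal_nonneg] at hν'
  have h5 := (ENNReal.ofReal_lt_ofReal_iff_of_nonneg (by positivity)).1 hν'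
  linarith

end Duality

end WeakTransport

/-! ### The duality theorem -/

theorem theorem9 {X : Type*} [MetricSpace X] [CompleteSpace X] [SecondCountableTopology X]
    [Nonempty X] [MeasurableSpace X] [BorelSpace X]
    (γ : ℝ≥0 → ℝ≥0) (hγ : WeakTransport.IsGrowthFunction γ)
    (c : X → WeakTransport.PGamma γ X → ℝ≥0∞) (hc : Measurable (Function.uncurry c))
    (hC : WeakTransport.CondC c ∨ WeakTransport.CondC' c ∨ WeakTransport.CondC'' c) :
    (∀ φ ∈ WeakTransport.PhiB γ X, Measurable (WeakTransport.Rc c φ)) ∧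
    ∀ μ ν : WeakTransport.PGamma γ X,
      ((WeakTransport.Tc c ν μ : ℝ≥0∞) : EReal) =
        ⨆ φ ∈ WeakTransport.PhiB γ X,
          (WeakTransport.extIntegral μ.meas (WeakTransport.Rc c φ)
            - ((∫ y, φ y ∂ν.meas : ℝ) : EReal)) := by
  obtain ⟨w, hw⟩ := hγ.exists_isControl (X := X)
  obtain ⟨hc1, hc2, hc4, hsel⟩ : WeakTransport.CondC1 c ∧ WeakTransport.CondC2 c ∧
      WeakTransport.CondC4 c ∧ ∀ f, WeakTransport.HasGrowth (WeakTransport.weight γ X) f →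
        (∀ x, 0 ≤ f x) → WeakTransport.HasSelection c f := by
    rcases hC with ⟨h1, h2, h3, h4⟩ | ⟨h1, h2, h3, h4⟩ | ⟨h2, h3, h4⟩
    · exact ⟨h1, h2, h4, fun f hf hf0 => hw.hasSelection_of_continuous hc h3 hf hf0⟩
    · exact ⟨h1, h2, h4, fun f hf hf0 => hw.hasSelection_of_compactSpace h3 hf hf0⟩
    · have := h3.1
      exact ⟨hw.condC1_of_discrete h3, h2, h4, fun f _ _ =>
        WeakTransport.hasSelection_of_countable⟩
  have hbdd : ∀ φ ∈ WeakTransport.PhiB γ X, ∃ m : ℝ≥0, ∀ x, 0 ≤ φ x + m := by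
    rintro φ ⟨-, b, hb⟩
    refine ⟨Real.toNNReal (-b), fun x => ?_⟩
    have h1 : b ≤ φ x := hb ⟨x, rfl⟩
    have h2 := Real.le_coe_toNNReal (-b)
    linarith
  have hmeas : ∀ φ, WeakTransport.HasGrowth (WeakTransport.weight γ X) φ → ∀ m : ℝ≥0,
      (∀ x, 0 ≤ φ x + m) → Measurable (WeakTransport.minCost c fun x => φ x + m) :=
    fun φ hφ m hm => (hsel _ (hw.hasGrowth_add_const hφ m) hm).1
  refine ⟨fun φ hφ => ?_, fun μ ν => le_antisymm ?_ (iSup₂_le fun φ hφ => ?_)⟩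
  · obtain ⟨m, hm⟩ := hbdd φ hφ
    rw [hw.Rc_eq hφ.1 hm]
    exact (WeakTransport.continuous_coe_sub_const m).measurable.comp (hmeas φ hφ.1 m hm)
  · have hle : ∀ φ, WeakTransport.HasGrowth (WeakTransport.weight γ X) φ → ∀ m : ℝ≥0,
        (∀ x, 0 ≤ φ x + m) →
        ((∫⁻ x, WeakTransport.minCost c (fun x => φ x + m) x ∂μ.meas : ℝ≥0∞) : EReal) -
          ((∫⁻ x, ENNReal.ofReal (φ x + m) ∂ν.meas : ℝ≥0∞) : EReal) ≤
        ⨆ φ ∈ WeakTransport.PhiB γ X, (WeakTransport.extIntegral μ.meas (WeakTransport.Rc c φ)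
          - ((∫ y, φ y ∂ν.meas : ℝ) : EReal)) := fun φ hφ m hm => by
      rw [← hw.dual_value_eq hφ hm (hmeas φ hφ m hm) μ ν]
      refine le_iSup₂_of_le φ ⟨hφ, -m, ?_⟩ le_rfl
      rintro _ ⟨x, rfl⟩
      linarith [hm x]
    refine le_of_forall_lt fun a ha => ?_
    obtain ⟨s, has, hs⟩ := EReal.lt_iff_exists_real_btwn.1 ha
    refine has.trans_le ?_
    -- For negative `s` the function `φ = 0` suffices, as its dual value is nonnegative.
    rcases lt_or_ge s 0 with hs0 | hs0
    · refine le_trans ?_ (hle (fun _ => 0)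
        (WeakTransport.hasGrowth_of_bounded (a := 0) continuous_const (by simp)) 0 (by simp))
      simp only [NNReal.coe_zero, add_zero, ENNReal.ofReal_zero, lintegral_zero,
        EReal.coe_ennreal_zero, sub_zero]
      exact (EReal.coe_nonpos.2 hs0.le).trans (EReal.coe_ennreal_nonneg _)
    · have hs' : ENNReal.ofReal s < WeakTransport.Tc c ν μ := by
        rw [← EReal.coe_ennreal_lt_coe_ennreal_iff, EReal.coe_ennreal_ofReal, max_eq_left hs0]
        exact hs
      obtain ⟨φ, hφ, m, hm, hval⟩ := hw.exists_phiB_lt hc hc1 hc2 hc4 hsel hs0 hs'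
      refine le_trans ?_ (hle φ hφ m hm)
      rw [hw.lintegral_add_const hφ hm] at hval ⊢
      rw [EReal.le_sub_iff_add_le (Or.inl (by simp)) (Or.inl (by simp))]
      rw [← EReal.coe_ennreal_le_coe_ennreal_iff, EReal.coe_ennreal_add] at hval
      rwa [EReal.coe_ennreal_ofReal (x := s), max_eq_left hs0] at hval
  · obtain ⟨m, hm⟩ := hbdd φ hφ
    rw [hw.dual_value_eq hφ.1 hm (hmeas φ hφ.1 m hm) μ ν]
    refine EReal.sub_le_of_le_add ?_
    rw [← EReal.coe_ennreal_add, EReal.coe_ennreal_le_coe_ennreal_iff]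
    exact hw.lintegral_minCost_le hc (hw.hasGrowth_add_const hφ.1 m).1.measurable μ ν
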